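/- **Theorem 1 (High probability oracular inequality).** *Setting.* Let $\mathcal A$ be a finite non-empty set, $\mathcal O$ a standard Borel space, $\mathcal Z$ a measurable space. Let $(\bar O_t)_{t\ge1}$, $\bar O_t=(O_{\alpha,t})_{\alpha\in\mathcal A}\in\mathcal O^{\mathcal A}$, be random variables on a probability space, $\bar Z_t=(Z_{\alpha,t})_{\alpha\in\mathcal A}=\mathrm{Summ}(\bar O_t)\in\mathcal Z^{\mathcal A}$ for a fixed measurable map $\mathrm{Summ}$ (possibly uninformative), and $F_t=\sigma(\bar O_1,\dots,\bar O_t)$ ($F_0$ trivial). Let $\Theta$ be a parameter space (a measurable space) and $\ell:\Theta\to\mathbb R^{\mathcal O\times\mathcal Z}$ a loss, jointly measurable, with every $\ell(\theta)(O_{\alpha,t},Z_{\alpha,t})$ square-integrable. Set $\bar\ell(\theta)(\bar O_t,\bar Z_t)=|\mathcal A|^{-1}\sum_{\alpha}\ell(\theta)(O_{\alpha,t},Z_{\alpha,t})$. Consider $J$ algorithms: for $1\le j\le J$ and $t\ge0$, $\theta_{j,t}\in\Theta_j\subset\Theta$ is a fixed measurable function of $\bar O_1,\dots,\bar O_t$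 ($\theta_{j,0}$ is a fixed element). For $t\ge1$ let $$\widetilde R_{j,t}=\frac1t\sum_{\tau=1}^t\mathbb E\big[\bar\ell(\theta_{j,\tau-1})(\bar O_\tau,\bar Z_\tau)\,\big|\,\bar Z_\tau,F_{\tau-1}\big],\qquad \widehat R_{j,t}=\frac1t\sum_{\tau=1}^t\bar\ell(\theta_{j,\tau-1})(\bar O_\tau,\bar Z_\tau),$$ let $\widetilde R_t(\theta)$ be $\widetilde R_{j,t}$ with every $\theta_{j,\tau-1}$ replaced by the fixed $\theta\in\Theta$, and let $\widehat\jmath_t\in\arg\min_j\widehat R_{j,t}$ (one-step ahead sequential Super Learner) and $\widetilde\jmath_t\in\arg\min_j\widetilde R_{j,t}$ (oracle), ties being broken arbitrarily. Let $\theta^\circ\in\Theta$ be such that, for all $t\ge1$, $\widetilde R_t(\theta^\circ)\le\widetilde R_t(\theta)$ almost surely for all $j$ and $\theta\in\Theta_j$, and write $\Delta^\circ\ell(\theta)=\ell(\theta)-\ell(\theta^\circ)$. *Assumptions.* * **A0.** $\mathcal G$ is a graph with vertex set $\mathcal A$ such that, for all $t\ge1$, if $\alpha\notin\mathcal A'\subset\mathcal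 A$ is not connected by any edge to any vertex of $\mathcal A'$, then $O_{\alpha,t}$ is conditionally independent of $(O_{\alpha',t})_{\alpha'\in\mathcal A'}$ given $\bar Z_t$ and $F_{t-1}$. Write $\deg(\mathcal G)$ for 1 plus the maximum degree of $\mathcal G$. * **A1.** Some $\theta^\star\in\Theta$ minimizes all the risks $\theta\mapsto\mathbb E[\ell(\theta)(O_{\alpha,t},Z_{\alpha,t})|Z_{\alpha,t},F_{t-1}]$ over $\Theta$ ($\alpha\in\mathcal A$, $t\ge1$). Moreover, for all $t\ge1$, $\theta\in\Theta$, every $F_{t-1}$-measurable $\theta_{t-1}$ with values in $\Theta$, and all integers $\varepsilon_1,\varepsilon_2\ge0$ with $\varepsilon_1+\varepsilon_2\le2$, almost surely, $$\mathbb E\Big[\sum_{\alpha}\ell(\theta_{t-1})(O_{\alpha,t},Z_{\alpha,t})^{\varepsilon_1}\ell(\theta)(O_{\alpha,t},Z_{\alpha,t})^{\varepsilon_2}\Big|\bar Z_t,F_{t-1}\Big]=\sum_{\alpha}\mathbb E\Big[\ell(\theta_{t-1})(O_{\alpha,t},Z_{\alpha,t})^{\varepsilon_1}\ell(\theta)(O_{\alpha,t},Z_{\alpha,t})^{\varepsilon_2}\Big|Z_{\alpha,t},F_{t-1}\Big].$$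 In A2–A4 the conditional moments given $(Z_{\alpha,t},F_{t-1})$ are computed from a regular conditional law of $O_{\alpha,t}$, and the inequalities hold almost surely, simultaneously for all $\alpha\in\mathcal A$, $t\ge1$, $\theta\in\Theta$; $X_{\alpha,t}(\theta)$ stands for $\Delta^\circ\ell(\theta)(O_{\alpha,t},Z_{\alpha,t})$. * **A2.** $b_1>0$, $\sup_\theta\|\Delta^\circ\ell(\theta)\|_\infty\le b_1$, $b_2\in\,]0,2b_1]$, and $|X_{\alpha,t}(\theta)-\mathbb E[X_{\alpha,t}(\theta)|Z_{\alpha,t},F_{t-1}]|\le b_2$. * **A3.** $\beta\in\,]0,1]$, $\gamma>0$, $\mathbb E[X_{\alpha,t}(\theta)|Z_{\alpha,t},F_{t-1}]\ge0$ and $\mathbb E[X_{\alpha,t}(\theta)^2|Z_{\alpha,t},F_{t-1}]\le\gamma\,(\mathbb E[X_{\alpha,t}(\theta)|Z_{\alpha,t},F_{t-1}])^\beta$. * **A4.** $v_1>0$ and $\mathrm{Var}[X_{\alpha,t}(\theta)|Z_{\alpha,t},F_{t-1}]\le v_1$. *Conclusion.* Let $v_2=\frac{3\pi}2\Big[\Big(\frac{15b_2}{|\mathcal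 A|/\deg(\mathcal G)}\Big)^2+\frac{64v_1}{|\mathcal A|/\deg(\mathcal G)}\Big]$. Fix integers $N,N'\ge2$ and a real $a>0$, and set $\underline x(a,N)=a[2^{-N}v_2/\gamma]^{1/\beta}$, $\underline x'(a,N')=ab_12^{-N'}$. For all $t\ge1$ and $x\ge\underline x(a,N)$, $$\mathbb P\Big[\widetilde R_{\widehat\jmath_t,t}-\widetilde R_t(\theta^\circ)\ge(1+2a)\big(\widetilde R_{\widetilde\jmath_t,t}-\widetilde R_t(\theta^\circ)\big)+x\Big]\le2JN\Big[\exp\Big(-\frac{t\,x^{2-\beta}}{C_1(a)}\Big)+\exp\Big(-\frac{t\,x}{C_2(a)}\Big)\Big],$$ where $C_1(a)=2^{5-\beta}(1+a)^2\gamma/a^\beta$ and $C_2(a)=8(1+a)b_2/3$. Moreover, for all $t\ge1$ and $x\ge\underline x'(a,N')$, the same probability is at most $$2e^2JN'\Big[\exp\Big(-\frac{[|\mathcal A|/(t^\beta\deg(\mathcal G))]\,x^{2-\beta}}{C_1'(a)}\Big)+\exp\Big(-\frac{[|\mathcal A|/\deg(\mathcal G)]\,x}{C_2'(a)}\Big)\Big],$$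 where $C_1'(a)=2^{6+2\beta}e^2(1+a)^2\gamma/a^\beta$ and $C_2'(a)=60e(1+a)b_2$. -/

import Mathlib

open MeasureTheory ProbabilityTheory

namespace SuperLearner

noncomputable section

/-! Time is indexed from `0`: `O s` is the collection of observations made at time `s + 1`, so that
`F_s` (the past of time `s + 1`) is generated by `O 0, …, O (s - 1)`. -/

section Observations

variable {Ω A 𝒪 𝒵 Θ : Type*}

/-- The collection of all the observations made in the slice `s`. -/
def slice (O : ℕ → A → Ω → 𝒪) (s : ℕ) (ω : Ω) : A → 𝒪 := fun α => O s α ω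

/-- The first `s` slices. -/
def history (O : ℕ → A → Ω → 𝒪) (s : ℕ) (ω : Ω) : Fin s → A → 𝒪 := fun i α => O i α ω

/-- The summary `Z_α` of the slice `s`, where `Summ` maps a slice to its summary. -/
def summary (Summ : (A → 𝒪) → A → 𝒵) (O : ℕ → A → Ω → 𝒪) (s : ℕ) (α : A) (ω : Ω) : 𝒵 :=
  Summ (slice O s ω) α

/-- The pair made of the summary `Z_α` of the slice `s` and of the first `s` slices. -/
def localInfo (Summ : (A → 𝒪) → A → 𝒵) (O : ℕ → A → Ω → 𝒪) (s : ℕ) (α : A) (ω : Ω) :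
    𝒵 × (Fin s → A → 𝒪) :=
  (summary Summ O s α ω, history O s ω)

/-- The pair made of the whole summary of the slice `s` and of the first `s` slices. -/
def sliceInfo (Summ : (A → 𝒪) → A → 𝒵) (O : ℕ → A → Ω → 𝒪) (s : ℕ) (ω : Ω) :
    (A → 𝒵) × (Fin s → A → 𝒪) :=
  (Summ (slice O s ω), history O s ω)

/-- `F_s`, generated by the first `s` slices; `F_0` is trivial. -/
abbrev pastSigma [MeasurableSpace 𝒪] (O : ℕ → A → Ω → 𝒪) (s : ℕ) : MeasurableSpace Ω :=
  MeasurableSpace.comap (history O s) inferInstance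

/-- The σ-field generated by `Z_α` (slice `s`) and `F_s`. -/
abbrev localSigma [MeasurableSpace 𝒪] [MeasurableSpace 𝒵] (Summ : (A → 𝒪) → A → 𝒵)
    (O : ℕ → A → Ω → 𝒪) (s : ℕ) (α : A) : MeasurableSpace Ω :=
  MeasurableSpace.comap (localInfo Summ O s α) inferInstance

/-- The σ-field generated by the whole summary of the slice `s` and `F_s`. -/
abbrev sliceSigma [MeasurableSpace 𝒪] [MeasurableSpace 𝒵] (Summ : (A → 𝒪) → A → 𝒵)
    (O : ℕ → A → Ω → 𝒪) (s : ℕ) : MeasurableSpace Ω :=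
  MeasurableSpace.comap (sliceInfo Summ O s) inferInstance

/-- The loss `ℓ(η)(O_α, Z_α)` in the slice `s`, for a possibly random parameter `η`. -/
def lossAt (ℓ : Θ → 𝒪 → 𝒵 → ℝ) (Summ : (A → 𝒪) → A → 𝒵) (O : ℕ → A → Ω → 𝒪)
    (η : Ω → Θ) (s : ℕ) (α : A) (ω : Ω) : ℝ :=
  ℓ (η ω) (O s α ω) (summary Summ O s α ω)

/-- The loss averaged over `α` in the slice `s`, for a possibly random parameter `η`. -/
def avgLossAt [Fintype A] (ℓ : Θ → 𝒪 → 𝒵 → ℝ) (Summ : (A → 𝒪) → A → 𝒵) (O : ℕ → A → Ω → 𝒪)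
    (η : Ω → Θ) (s : ℕ) (ω : Ω) : ℝ :=
  (1 / (Fintype.card A : ℝ)) * ∑ α, lossAt ℓ Summ O η s α ω

/-- A learning algorithm maps the first `s` slices to a parameter, for every `s`. For `s = 0` this
is a fixed parameter. -/
abbrev Algorithm (A 𝒪 Θ : Type*) := (s : ℕ) → (Fin s → A → 𝒪) → Θ

/-- The algorithm that does not learn, and always returns `θ`. -/
def constAlg (θ : Θ) : Algorithm A 𝒪 Θ := fun _ _ => θ

/-- The parameter learned from the first `s` slices. -/
def learned (alg : Algorithm A 𝒪 Θ) (O : ℕ → A → Ω → 𝒪) (s : ℕ) (ω : Ω) : Θ :=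
  alg s (history O s ω)

/-- The average cumulative conditional risk of an algorithm till time `t`. -/
def risk [Fintype A] [MeasurableSpace 𝒪] [MeasurableSpace 𝒵] [MeasurableSpace Ω] (μ : Measure Ω)
    (ℓ : Θ → 𝒪 → 𝒵 → ℝ) (Summ : (A → 𝒪) → A → 𝒵) (O : ℕ → A → Ω → 𝒪)
    (alg : Algorithm A 𝒪 Θ) (t : ℕ) (ω : Ω) : ℝ :=
  (1 / (t : ℝ)) * ∑ s ∈ Finset.range t,
    (μ[avgLossAt ℓ Summ O (learned alg O s) s | sliceSigma Summ O s]) ω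

/-- The empirical risk of an algorithm till time `t`. -/
def empRisk [Fintype A] (ℓ : Θ → 𝒪 → 𝒵 → ℝ) (Summ : (A → 𝒪) → A → 𝒵) (O : ℕ → A → Ω → 𝒪)
    (alg : Algorithm A 𝒪 Θ) (t : ℕ) (ω : Ω) : ℝ :=
  (1 / (t : ℝ)) * ∑ s ∈ Finset.range t, avgLossAt ℓ Summ O (learned alg O s) s ω

end Observations

section Assumptions

variable {Ω A 𝒪 𝒵 Θ : Type*}

/-- Conditional independence of two random elements given a σ-field `m`. -/
def CondIndepGiven {X Y : Type*} [MeasurableSpace X] [MeasurableSpace Y] [MeasurableSpace Ω]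
    (μ : Measure Ω) (m : MeasurableSpace Ω) (f : Ω → X) (g : Ω → Y) : Prop :=
  ∀ (B : Set X) (C : Set Y), MeasurableSet B → MeasurableSet C →
    μ[(f ⁻¹' B ∩ g ⁻¹' C).indicator (fun _ => (1 : ℝ)) | m] =ᵐ[μ]
      μ[(f ⁻¹' B).indicator (fun _ => (1 : ℝ)) | m] *
        μ[(g ⁻¹' C).indicator (fun _ => (1 : ℝ)) | m]

/-- `G` is a conditional dependency graph within each slice. -/
def DependencyGraph [MeasurableSpace 𝒪] [MeasurableSpace 𝒵] [MeasurableSpace Ω] (μ : Measure Ω)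
    (Summ : (A → 𝒪) → A → 𝒵) (O : ℕ → A → Ω → 𝒪) (G : SimpleGraph A) : Prop :=
  ∀ (s : ℕ) (α : A) (A' : Set A), α ∉ A' → (∀ α' ∈ A', ¬ G.Adj α α') →
    CondIndepGiven μ (sliceSigma Summ O s) (O s α) (fun ω (α' : A') => O s α' ω)

/-- `θstar` minimizes all the conditional risks, and the conditional first and second order moments
of the losses, summed over `α`, are the same given the whole summary or the `α`-specific ones. The
square-integrability makes all these conditional moments meaningful. -/
structure SharedRisk [Fintype A] [MeasurableSpace 𝒪] [MeasurableSpace 𝒵] [MeasurableSpace Θ]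
    [MeasurableSpace Ω] (μ : Measure Ω) (ℓ : Θ → 𝒪 → 𝒵 → ℝ) (Summ : (A → 𝒪) → A → 𝒵)
    (O : ℕ → A → Ω → 𝒪) (θstar : Θ) : Prop where
  sq_integrable : ∀ (θ : Θ) (s : ℕ) (α : A), MemLp (lossAt ℓ Summ O (fun _ => θ) s α) 2 μ
  minimizer : ∀ (θ : Θ) (s : ℕ) (α : A),
    μ[lossAt ℓ Summ O (fun _ => θstar) s α | localSigma Summ O s α] ≤ᵐ[μ]
      μ[lossAt ℓ Summ O (fun _ => θ) s α | localSigma Summ O s α]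
  moments : ∀ (θ : Θ) (s : ℕ) (η : Ω → Θ), Measurable[pastSigma O s] η →
    ∀ ε₁ ε₂ : ℕ, ε₁ + ε₂ ≤ 2 →
      μ[fun ω => ∑ α, lossAt ℓ Summ O η s α ω ^ ε₁ * lossAt ℓ Summ O (fun _ => θ) s α ω ^ ε₂ |
          sliceSigma Summ O s] =ᵐ[μ]
        fun ω => ∑ α,
          (μ[fun ω' => lossAt ℓ Summ O η s α ω' ^ ε₁ * lossAt ℓ Summ O (fun _ => θ) s α ω' ^ ε₂ |
            localSigma Summ O s α]) ω

/-- `Δ°ℓ(θ) = ℓ(θ) - ℓ(θ°)`. -/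
def excessLoss (ℓ : Θ → 𝒪 → 𝒵 → ℝ) (θo θ : Θ) (o : 𝒪) (z : 𝒵) : ℝ := ℓ θ o z - ℓ θo o z

/-- The (regular) conditional law of `O_α` in the slice `s` given `Z_α` and `F_s`, at `ω`. -/
def condLaw [MeasurableSpace 𝒪] [StandardBorelSpace 𝒪] [Nonempty 𝒪] [MeasurableSpace 𝒵]
    [MeasurableSpace Ω] (μ : Measure Ω) [IsFiniteMeasure μ] (Summ : (A → 𝒪) → A → 𝒵)
    (O : ℕ → A → Ω → 𝒪) (s : ℕ) (α : A) (ω : Ω) : Measure 𝒪 :=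
  condDistrib (O s α) (localInfo Summ O s α) μ (localInfo Summ O s α ω)

/-- The conditional expectation of `g(O_α, Z_α)` given `Z_α` and `F_s` in the slice `s`, computed
from the conditional law. With this version one can speak of all `g` at once, almost surely. -/
def condMean [MeasurableSpace 𝒪] [StandardBorelSpace 𝒪] [Nonempty 𝒪] [MeasurableSpace 𝒵]
    [MeasurableSpace Ω] (μ : Measure Ω) [IsFiniteMeasure μ] (Summ : (A → 𝒪) → A → 𝒵)
    (O : ℕ → A → Ω → 𝒪) (s : ℕ) (α : A) (g : 𝒪 → 𝒵 → ℝ) (ω : Ω) : ℝ :=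
  ∫ o, g o (summary Summ O s α ω) ∂(condLaw μ Summ O s α ω)

/-- The conditional variance of `g(O_α, Z_α)` given `Z_α` and `F_s` in the slice `s`. -/
def condVariance [MeasurableSpace 𝒪] [StandardBorelSpace 𝒪] [Nonempty 𝒪] [MeasurableSpace 𝒵]
    [MeasurableSpace Ω] (μ : Measure Ω) [IsFiniteMeasure μ] (Summ : (A → 𝒪) → A → 𝒵)
    (O : ℕ → A → Ω → 𝒪) (s : ℕ) (α : A) (g : 𝒪 → 𝒵 → ℝ) (ω : Ω) : ℝ :=
  variance (fun o => g o (summary Summ O s α ω)) (condLaw μ Summ O s α ω)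

/-- Bounded losses. -/
structure BoundedLoss [MeasurableSpace 𝒪] [StandardBorelSpace 𝒪] [Nonempty 𝒪] [MeasurableSpace 𝒵]
    [MeasurableSpace Ω] (μ : Measure Ω) [IsFiniteMeasure μ] (ℓ : Θ → 𝒪 → 𝒵 → ℝ)
    (Summ : (A → 𝒪) → A → 𝒵) (O : ℕ → A → Ω → 𝒪) (θo : Θ) (b₁ b₂ : ℝ) : Prop where
  b₁_pos : 0 < b₁
  b₂_pos : 0 < b₂
  b₂_le : b₂ ≤ 2 * b₁
  sup_le : ∀ (θ : Θ) (o : 𝒪) (z : 𝒵), |excessLoss ℓ θo θ o z| ≤ b₁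
  centered_le : ∀ᵐ ω ∂μ, ∀ (s : ℕ) (α : A) (θ : Θ),
    |excessLoss ℓ θo θ (O s α ω) (summary Summ O s α ω)
      - condMean μ Summ O s α (excessLoss ℓ θo θ) ω| ≤ b₂

/-- Variance bound with exponent `β`. The nonnegativity of the conditional mean is what gives a
meaning to its power `β`. -/
structure VarianceBound [MeasurableSpace 𝒪] [StandardBorelSpace 𝒪] [Nonempty 𝒪]
    [MeasurableSpace 𝒵] [MeasurableSpace Ω] (μ : Measure Ω) [IsFiniteMeasure μ]
    (ℓ : Θ → 𝒪 → 𝒵 → ℝ) (Summ : (A → 𝒪) → A → 𝒵) (O : ℕ → A → Ω → 𝒪) (θo : Θ) (β γ : ℝ) :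
    Prop where
  β_pos : 0 < β
  β_le : β ≤ 1
  γ_pos : 0 < γ
  bound : ∀ᵐ ω ∂μ, ∀ (s : ℕ) (α : A) (θ : Θ),
    0 ≤ condMean μ Summ O s α (excessLoss ℓ θo θ) ω ∧
    condMean μ Summ O s α (fun o z => excessLoss ℓ θo θ o z ^ 2) ω ≤
      γ * condMean μ Summ O s α (excessLoss ℓ θo θ) ω ^ β

/-- Bounded conditional variances. -/
structure BoundedCondVariance [MeasurableSpace 𝒪] [StandardBorelSpace 𝒪] [Nonempty 𝒪]
    [MeasurableSpace 𝒵] [MeasurableSpace Ω] (μ : Measure Ω) [IsFiniteMeasure μ]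
    (ℓ : Θ → 𝒪 → 𝒵 → ℝ) (Summ : (A → 𝒪) → A → 𝒵) (O : ℕ → A → Ω → 𝒪) (θo : Θ) (v₁ : ℝ) :
    Prop where
  v₁_pos : 0 < v₁
  bound : ∀ᵐ ω ∂μ, ∀ (s : ℕ) (α : A) (θ : Θ),
    condVariance μ Summ O s α (excessLoss ℓ θo θ) ω ≤ v₁

end Assumptions

section Constants

/-- One plus the maximum degree of `G`. -/
def graphDeg {A : Type*} [Fintype A] (G : SimpleGraph A) [DecidableRel G.Adj] : ℝ :=
  (G.maxDegree : ℝ) + 1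

/-- `|A| / deg G`. -/
def ratio {A : Type*} [Fintype A] (G : SimpleGraph A) [DecidableRel G.Adj] : ℝ :=
  (Fintype.card A : ℝ) / graphDeg G

/-- `v₂`, where `r = |A| / deg G`. -/
def v₂ (r b₂ v₁ : ℝ) : ℝ := 3 * Real.pi / 2 * ((15 * b₂ / r) ^ 2 + 64 * v₁ / r)

/-- The threshold `x(a, N)`. -/
def xLow (r b₂ v₁ β γ a : ℝ) (N : ℕ) : ℝ := a * ((2 : ℝ) ^ (-(N : ℝ)) * v₂ r b₂ v₁ / γ) ^ (1 / β)

/-- The threshold `x'(a, N')`. -/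
def xLow' (b₁ a : ℝ) (N' : ℕ) : ℝ := a * b₁ * (2 : ℝ) ^ (-(N' : ℝ))

/-- `C₁(a)`. -/
def C₁ (β γ a : ℝ) : ℝ := (2 : ℝ) ^ (5 - β) * (1 + a) ^ 2 * γ / a ^ β

/-- `C₂(a)`. -/
def C₂ (b₂ a : ℝ) : ℝ := 8 * (1 + a) * b₂ / 3

/-- `C₁'(a)`. -/
def C₁' (β γ a : ℝ) : ℝ :=
  (2 : ℝ) ^ (6 + 2 * β) * Real.exp 1 ^ 2 * (1 + a) ^ 2 * γ / a ^ β

/-- `C₂'(a)`. -/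
def C₂' (b₂ a : ℝ) : ℝ := 60 * Real.exp 1 * (1 + a) * b₂

end Constants

end

end SuperLearner

namespace SuperLearner

/-! Write `H` for the cumulative conditional excess risk of an algorithm (`cumRisk`) and `D` for its
averaged deviation (`cumDeviation`), so that its empirical excess risk is `D + H`. Empirical
minimality gives `D̂ + Ĥ ≤ D̃ + H̃`. If moreover `Ĥ ≥ (1 + 2a) H̃ + x`, then one of the two
deviations is large relative to its own risk: `(1 + a)(-D̂) ≥ x/2 + a Ĥ` or `(1 + a) D̃ ≥ x/2 + a
H̃`. A union bound over `J` algorithms and two signs (`measure_oracle_le`) leaves a one-algorithm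
estimate, `measure_deviation_le`.

That estimate is a Chernoff bound along an exponential supermartingale. Given the summary of a slice
and the past, the deviation is sub-gamma with variance factor `γ h ^ β / ρ`, where `h` is the excess
risk in the slice. Jensen over time bounds the total variance by a multiple of `t * H ^ β`, and
weighted AM-GM bounds `a ^ β * H ^ β * y ^ (1 - β)` by `a H + y`, which is the penalty already
present in the event. The random variance is thus absorbed without stratifying the values of `H`,
and the bound, with prefactor `2J`, holds for every `x > 0`. The thresholds on `x` serve to ensure
positivity, and the factors `N`, `N'` and `e²` are slack.

The two conclusions differ by the sub-gamma input. With `ρ = 1` (`hasSubgammaDeviations_one`) the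
average over `α` is treated as a single bounded variable, with Bernstein's inequality. With `ρ` a
quarter of `ratio G` (`hasSubgammaDeviations_ratio`) Janson's method is used: color the dependency
graph, apply Bernstein inside each independent color class, and recombine the classes by convexity.
In both cases `ae_slice_bounds` transfers the assumptions, which are given the local summaries, to
the conditional law given the whole summary. -/

lemma two_mul_three_pow_le_factorial (n : ℕ) : 2 * 3 ^ n ≤ (n + 2).factorial := by
  induction n with
  | zero => simp
  | succ n ih =>
    rw [show n + 1 + 2 = (n + 2) + 1 from rfl, Nat.factorial_succ, pow_succ]
    nlinarith

/-- Since `(n + 2)! ≥ 2 * 3 ^ n`, the exponential series from its quadratic term on is dominated by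
a geometric series of ratio `c / 3`. -/
lemma exp_le_quadratic {x c : ℝ} (hx : |x| ≤ c) (hc : c < 3) :
    Real.exp x ≤ 1 + x + x ^ 2 / (2 * (1 - c / 3)) := by
  have h1 := NormedSpace.expSeries_div_hasSum_exp x
  rw [← Real.exp_eq_exp_ℝ] at h1
  have h2 := (hasSum_nat_add_iff' 2).2 h1
  have hc0 : 0 ≤ c := (abs_nonneg x).trans hx
  have h3 : HasSum (fun n : ℕ => x ^ 2 / 2 * (c / 3) ^ n) (x ^ 2 / 2 * (1 - c / 3)⁻¹) :=
    (hasSum_geometric_of_lt_one (by positivity) (by linarith)).mul_left _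
  have h4 := hasSum_le (fun n => ?_) h2 h3
  · simp [Finset.sum_range_succ] at h4
    have : x ^ 2 / 2 * (1 - c / 3)⁻¹ = x ^ 2 / (2 * (1 - c / 3)) := by
      rw [div_mul_eq_div_div, div_eq_mul_inv (x ^ 2 / 2)]
    linarith
  · have h5 : (2 * 3 ^ n : ℝ) ≤ ((n + 2).factorial : ℝ) := by
      exact_mod_cast two_mul_three_pow_le_factorial n
    have h6 : x ^ n ≤ c ^ n := by
      calc x ^ n ≤ |x ^ n| := le_abs_self _
        _ = |x| ^ n := abs_pow _ _
        _ ≤ c ^ n := by gcongr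
    calc x ^ (n + 2) / ((n + 2).factorial : ℝ) = x ^ 2 * x ^ n / ((n + 2).factorial : ℝ) := by
          rw [pow_add, mul_comm]
      _ ≤ x ^ 2 * c ^ n / ((n + 2).factorial : ℝ) := by gcongr
      _ ≤ x ^ 2 * c ^ n / (2 * 3 ^ n) := by gcongr
      _ = x ^ 2 / 2 * (c / 3) ^ n := by rw [div_pow]; ring

/-! ### Bernstein's inequality for one variable -/

section MomentGenerating

variable {Ω : Type*} [MeasurableSpace Ω] {P : Measure Ω} [IsProbabilityMeasure P]

lemma integrable_of_ae_abs_le {Y : Ω → ℝ} (hY : Measurable Y) {b : ℝ}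
    (hb : ∀ᵐ ω ∂P, |Y ω| ≤ b) : Integrable Y P :=
  .of_bound hY.aestronglyMeasurable b hb

lemma integrable_exp_of_ae_abs_le {Y : Ω → ℝ} (hY : Measurable Y) {b : ℝ}
    (hb : ∀ᵐ ω ∂P, |Y ω| ≤ b) (u : ℝ) : Integrable (fun ω => Real.exp (u * Y ω)) P := by
  refine .of_bound (by fun_prop) (Real.exp (|u| * b)) ?_
  filter_upwards [hb] with ω hω
  rw [Real.norm_eq_abs, Real.abs_exp]
  refine Real.exp_le_exp.2 ?_
  calc u * Y ω ≤ |u * Y ω| := le_abs_self _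
    _ = |u| * |Y ω| := abs_mul _ _
    _ ≤ |u| * b := by gcongr

/-- Bernstein's bound for the moment generating function of a bounded centered variable. -/
lemma mgf_le_bernstein {Y : Ω → ℝ} (hY : Measurable Y) {b u : ℝ}
    (hb : ∀ᵐ ω ∂P, |Y ω| ≤ b) (h0 : ∫ ω, Y ω ∂P = 0) (hu : |u| * b < 3) :
    mgf Y P u ≤ Real.exp (u ^ 2 * (∫ ω, Y ω ^ 2 ∂P) / (2 * (1 - |u| * b / 3))) := by
  have hi : Integrable Y P := integrable_of_ae_abs_le hY hb
  have hi2 : Integrable (fun ω => Y ω ^ 2) P := by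
    refine .of_bound (by fun_prop) (b ^ 2) ?_
    filter_upwards [hb] with ω hω
    rw [Real.norm_eq_abs, abs_pow]
    gcongr
  set k : ℝ := 2 * (1 - |u| * b / 3)
  have h1 : mgf Y P u ≤ ∫ ω, (1 + u * Y ω + u ^ 2 / k * Y ω ^ 2) ∂P := by
    refine integral_mono_ae (integrable_exp_of_ae_abs_le hY hb u) ?_ ?_
    · exact ((integrable_const _).add (hi.const_mul u)).add (hi2.const_mul _)
    · filter_upwards [hb] with ω hω
      have h2 : |u * Y ω| ≤ |u| * b := by rw [abs_mul]; gcongr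
      have := exp_le_quadratic h2 hu
      calc Real.exp (u * Y ω) ≤ 1 + u * Y ω + (u * Y ω) ^ 2 / k := this
        _ = _ := by ring
  have h3 : ∫ ω, (1 + u * Y ω + u ^ 2 / k * Y ω ^ 2) ∂P
      = ∫ ω, (1 + u * Y ω) ∂P + ∫ ω, u ^ 2 / k * Y ω ^ 2 ∂P :=
    integral_add ((integrable_const _).add (hi.const_mul u)) (hi2.const_mul _)
  rw [h3, integral_add (integrable_const _) (hi.const_mul u), integral_const_mul,
    integral_const_mul, h0] at h1
  simp only [integral_const, probReal_univ, smul_eq_mul, mul_one, mul_zero, add_zero] at h1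
  refine h1.trans ?_
  rw [add_comm, mul_div_right_comm]
  exact Real.add_one_le_exp _

end MomentGenerating

/-! ### Greedy coloring and weights for the color classes -/

section Coloring

variable {A : Type*} [Fintype A] (G : SimpleGraph A) [DecidableRel G.Adj]

/-- Greedy coloring: a finite graph has a proper coloring with `maxDegree + 1` colors. -/
lemma exists_coloring_maxDegree_succ :
    ∃ c : A → Fin (G.maxDegree + 1), ∀ α α', G.Adj α α' → c α ≠ c α' := by
  classical
  suffices h : ∀ s : Finset A, ∃ c : A → Fin (G.maxDegree + 1),
      ∀ α ∈ s, ∀ α' ∈ s, G.Adj α α' → c α ≠ c α' by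
    obtain ⟨c, hc⟩ := h Finset.univ
    exact ⟨c, fun α α' => hc α (Finset.mem_univ _) α' (Finset.mem_univ _)⟩
  intro s
  induction s using Finset.induction_on with
  | empty => exact ⟨fun _ => 0, by simp⟩
  | insert v s hv ih =>
    obtain ⟨c, hc⟩ := ih
    -- The neighbors of `v` use at most `maxDegree` colors, so one color remains free for `v`.
    have hcard : ((G.neighborFinset v).image c).card <
        (Finset.univ : Finset (Fin (G.maxDegree + 1))).card := by
      rw [Finset.card_univ, Fintype.card_fin, Nat.lt_succ_iff]
      exact Finset.card_image_le.trans (G.degree_le_maxDegree v)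
    obtain ⟨k, -, hk⟩ := Finset.exists_mem_notMem_of_card_lt_card hcard
    have hk' : ∀ α, G.Adj v α → c α ≠ k := fun α hα h =>
      hk (Finset.mem_image.2 ⟨α, by simpa using hα, h⟩)
    refine ⟨Function.update c v k, fun α hα α' hα' hadj => ?_⟩
    by_cases h1 : α = v
    · subst h1
      have h2 : α' ≠ α := hadj.ne'
      rw [Function.update_self, Function.update_of_ne h2]
      exact (hk' α' hadj).symm
    · by_cases h2 : α' = v
      · subst h2
        rw [Function.update_self, Function.update_of_ne h1]
        exact hk' α hadj.symm
      · rw [Function.update_of_ne h1, Function.update_of_ne h2]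
        exact hc α (by simpa [h1] using hα) α' (by simpa [h2] using hα') hadj

end Coloring

/-- Mix equally the uniform weights and the weights proportional to `S`. The uniform half controls
`1 / p`, hence the range of the rescaled variables; AM-GM between the halves gives `p ^ 2 ≥ S / (n *
∑ S)`, hence controls the rescaled variances. -/
lemma exists_weights {n : ℕ} (hn : 0 < n) (S : Fin n → ℝ) (hS : ∀ c, 0 ≤ S c) :
    ∃ p : Fin n → ℝ, (∀ c, 0 < p c) ∧ ∑ c, p c = 1 ∧ (∀ c, (p c)⁻¹ ≤ 2 * n) ∧
      ∀ c, S c * (p c)⁻¹ ^ 2 ≤ n * ∑ c', S c' := by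
  have hn' : (0 : ℝ) < n := by exact_mod_cast hn
  have hT : 0 ≤ ∑ c, S c := Finset.sum_nonneg fun c _ => hS c
  rcases hT.eq_or_lt with h0 | hpos
  · have hz : ∀ c, S c = 0 := fun c =>
      (Finset.sum_eq_zero_iff_of_nonneg fun c _ => hS c).1 h0.symm c (Finset.mem_univ c)
    refine ⟨fun _ => ((n : ℝ))⁻¹, fun _ => by positivity, ?_, fun _ => ?_, fun c => ?_⟩
    · simp [hn'.ne']
    · rw [inv_inv]; linarith
    · simp [hz]
  · set T := ∑ c, S c
    refine ⟨fun c => (2 * (n : ℝ))⁻¹ + S c / (2 * T), fun c => ?_, ?_, fun c => ?_, fun c => ?_⟩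
    · have := hS c; positivity
    · rw [Finset.sum_add_distrib, ← Finset.sum_div]
      simp only [Finset.sum_const, Finset.card_univ, Fintype.card_fin, nsmul_eq_mul]
      change (n : ℝ) * (2 * (n : ℝ))⁻¹ + T / (2 * T) = 1
      field_simp
      norm_num
    · rw [inv_le_comm₀ (by have := hS c; positivity) (by positivity)]
      have := hS c
      have : 0 ≤ S c / (2 * T) := by positivity
      linarith
    · have h1 := hS c
      have hp : 0 < (2 * (n : ℝ))⁻¹ + S c / (2 * T) := by positivity
      rw [inv_pow, ← div_eq_mul_inv, div_le_iff₀ (by positivity)]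
      have h2 : 4 * ((2 * (n : ℝ))⁻¹ * (S c / (2 * T))) ≤ ((2 * (n : ℝ))⁻¹ + S c / (2 * T)) ^ 2 := by
        nlinarith [sq_nonneg ((2 * (n : ℝ))⁻¹ - S c / (2 * T))]
      calc S c = n * T * (4 * ((2 * (n : ℝ))⁻¹ * (S c / (2 * T)))) := by field_simp; norm_num
        _ ≤ _ := by gcongr

/-! ### Exponential moments under a dependency graph -/

section DependencyGraphs

variable {Ω A : Type*} [MeasurableSpace Ω] {P : Measure Ω} [IsProbabilityMeasure P]

/-- Vertices of an independent set are added one at a time: each is independent of the sum of the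
previous ones, so the generating functions multiply and the Bernstein exponents add. -/
lemma mgf_sum_le_of_independent_set {G : SimpleGraph A} {Y : A → Ω → ℝ}
    (hY : ∀ α, Measurable (Y α)) {b u : ℝ} (hb : ∀ α, ∀ᵐ ω ∂P, |Y α ω| ≤ b)
    (h0 : ∀ α, ∫ ω, Y α ω ∂P = 0)
    (hind : ∀ (α : A) (I : Finset A), α ∉ I → (∀ α' ∈ I, ¬ G.Adj α α') →
      IndepFun (Y α) (fun ω => ∑ i ∈ I, Y i ω) P)
    (hu : |u| * b < 3) (I : Finset A) (hI : ∀ α ∈ I, ∀ α' ∈ I, ¬ G.Adj α α') :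
    mgf (fun ω => ∑ i ∈ I, Y i ω) P u ≤
      Real.exp (u ^ 2 * (∑ i ∈ I, ∫ ω, Y i ω ^ 2 ∂P) / (2 * (1 - |u| * b / 3))) := by
  classical
  induction I using Finset.induction_on with
  | empty => simp [mgf]
  | insert v I hv ih =>
    have h1 := ih fun α hα α' hα' =>
      hI α (Finset.mem_insert_of_mem hα) α' (Finset.mem_insert_of_mem hα')
    have h2 := hind v I hv fun α' hα' =>
      hI v (Finset.mem_insert_self _ _) α' (Finset.mem_insert_of_mem hα')
    have h3 : (fun ω => ∑ i ∈ insert v I, Y i ω) = Y v + fun ω => ∑ i ∈ I, Y i ω := by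
      ext ω; simp [Finset.sum_insert hv]
    have hm : Measurable fun ω => ∑ i ∈ I, Y i ω := by fun_prop
    rw [h3, h2.mgf_add' (hY v).aestronglyMeasurable hm.aestronglyMeasurable,
      Finset.sum_insert hv, mul_add, add_div, Real.exp_add]
    gcongr
    · exact mgf_nonneg
    · exact mgf_le_bernstein (hY v) (hb v) (h0 v) hu

/-- Janson's bound for the moment generating function of a sum of bounded centered variables with
a dependency graph. -/
lemma mgf_sum_le_of_dependencyGraph [Fintype A] (G : SimpleGraph A) [DecidableRel G.Adj]
    {Y : A → Ω → ℝ} (hY : ∀ α, Measurable (Y α)) {b u : ℝ} (hb0 : 0 ≤ b)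
    (hb : ∀ α, ∀ᵐ ω ∂P, |Y α ω| ≤ b)
    (h0 : ∀ α, ∫ ω, Y α ω ∂P = 0)
    (hind : ∀ (α : A) (I : Finset A), α ∉ I → (∀ α' ∈ I, ¬ G.Adj α α') →
      IndepFun (Y α) (fun ω => ∑ i ∈ I, Y i ω) P)
    (hu : 2 * graphDeg G * |u| * b < 3) :
    mgf (fun ω => ∑ α, Y α ω) P u ≤
      Real.exp (u ^ 2 * graphDeg G * (∑ α, ∫ ω, Y α ω ^ 2 ∂P) /
        (2 * (1 - 2 * graphDeg G * |u| * b / 3))) := by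
  classical
  obtain ⟨c, hc⟩ := exists_coloring_maxDegree_succ G
  have hdeg : graphDeg G = ((G.maxDegree + 1 : ℕ) : ℝ) := by simp [graphDeg]
  set V : A → ℝ := fun α => ∫ ω, Y α ω ^ 2 ∂P
  have hV : ∀ α, 0 ≤ V α := fun α => integral_nonneg fun ω => sq_nonneg _
  let cls : Fin (G.maxDegree + 1) → Finset A := fun k => Finset.univ.filter fun α => c α = k
  obtain ⟨p, hp, hp1, hpi, hpS⟩ := exists_weights (Nat.succ_pos G.maxDegree)
    (fun k => ∑ α ∈ cls k, V α) fun k => Finset.sum_nonneg fun α _ => hV α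
  have hfib : ∀ f : A → ℝ, ∑ k, ∑ α ∈ cls k, f α = ∑ α, f α := fun f =>
    Finset.sum_fiberwise Finset.univ c f
  simp only [hfib] at hpS
  rw [← Nat.succ_eq_add_one] at hdeg
  rw [← hdeg] at hpi hpS
  set T := ∑ α, V α
  have hYb : ∀ s : Finset A, ∀ᵐ ω ∂P, |∑ i ∈ s, Y i ω| ≤ s.card * b := fun s => by
    filter_upwards [ae_all_iff.2 hb] with ω hω
    calc |∑ i ∈ s, Y i ω| ≤ ∑ i ∈ s, |Y i ω| := Finset.abs_sum_le_sum_abs _ _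
      _ ≤ ∑ i ∈ s, b := Finset.sum_le_sum fun i _ => hω i
      _ = s.card * b := by simp
  have hYm : ∀ s : Finset A, Measurable fun ω => ∑ i ∈ s, Y i ω := fun s => by fun_prop
  -- The total is the `p`-average of the class sums rescaled by `1 / p k`; convexity of `exp` then
  -- needs no independence between classes.
  have hconv : mgf (fun ω => ∑ α, Y α ω) P u ≤
      ∑ k, p k * mgf (fun ω => ∑ α ∈ cls k, Y α ω) P (u * (p k)⁻¹) := by
    have hint : ∀ k, Integrable
        (fun ω => p k * Real.exp (u * (p k)⁻¹ * ∑ α ∈ cls k, Y α ω)) P := fun k =>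
      (integrable_exp_of_ae_abs_le (hYm _) (hYb _) _).const_mul _
    simp only [mgf, ← integral_const_mul]
    rw [← integral_finsetSum _ fun k _ => hint k]
    refine integral_mono (integrable_exp_of_ae_abs_le (hYm _) (hYb _) _)
      (integrable_finsetSum _ fun k _ => hint k) fun ω => ?_
    have := convexOn_exp.map_sum_le (t := Finset.univ) (w := p)
      (p := fun k => u * (p k)⁻¹ * ∑ α ∈ cls k, Y α ω)
      (fun k _ => (hp k).le) hp1 (fun _ _ => Set.mem_univ _)
    simp only [smul_eq_mul] at this
    refine le_trans (le_of_eq ?_) this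
    congr 1
    rw [← hfib, Finset.mul_sum]
    refine Finset.sum_congr rfl fun k _ => ?_
    have := (hp k).ne'
    field_simp
  refine hconv.trans ?_
  have hterm : ∀ k, mgf (fun ω => ∑ α ∈ cls k, Y α ω) P (u * (p k)⁻¹) ≤
      Real.exp (u ^ 2 * graphDeg G * T / (2 * (1 - 2 * graphDeg G * |u| * b / 3))) := fun k => by
    have h1 : |u * (p k)⁻¹| * b ≤ 2 * graphDeg G * |u| * b := by
      rw [abs_mul, abs_of_pos (inv_pos.2 (hp k)), mul_comm |u|]
      have := hpi k
      gcongr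
    refine (mgf_sum_le_of_independent_set hY hb h0 hind (h1.trans_lt hu) (cls k) ?_).trans ?_
    · intro α hα α' hα' hadj
      simp only [cls, Finset.mem_filter, Finset.mem_univ, true_and] at hα hα'
      exact hc α α' hadj (hα.trans hα'.symm)
    · apply Real.exp_le_exp.2
      have hT : 0 ≤ T := Finset.sum_nonneg fun α _ => hV α
      have hg : 0 ≤ graphDeg G := by rw [hdeg]; positivity
      apply div_le_div₀ (by positivity) _ (by linarith) (by linarith)
      calc (u * (p k)⁻¹) ^ 2 * ∑ i ∈ cls k, V i
          = u ^ 2 * ((∑ i ∈ cls k, V i) * (p k)⁻¹ ^ 2) := by ring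
        _ ≤ u ^ 2 * (graphDeg G * T) := mul_le_mul_of_nonneg_left (hpS k) (sq_nonneg u)
        _ = _ := by ring
  calc _ ≤ ∑ k, p k * Real.exp (u ^ 2 * graphDeg G * T /
        (2 * (1 - 2 * graphDeg G * |u| * b / 3))) :=
        Finset.sum_le_sum fun k _ => mul_le_mul_of_nonneg_left (hterm k) (hp k).le
    _ = _ := by rw [← Finset.sum_mul, hp1, one_mul]

end DependencyGraphs

/-! ### Two power inequalities -/

/-- Jensen for the concave power `β`. It serves twice: over `α` within a slice, then over time. -/
lemma sum_rpow_le_card_mul {ι : Type*} (s : Finset ι) (hs : s.Nonempty) {f : ι → ℝ}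
    (hf : ∀ i ∈ s, 0 ≤ f i) {β : ℝ} (hβ0 : 0 ≤ β) (hβ1 : β ≤ 1) :
    ∑ i ∈ s, f i ^ β ≤ s.card * ((1 / (s.card : ℝ)) * ∑ i ∈ s, f i) ^ β := by
  have hc : (0 : ℝ) < s.card := by exact_mod_cast hs.card_pos
  have := (Real.concaveOn_rpow hβ0 hβ1).le_map_sum (t := s) (w := fun _ => 1 / (s.card : ℝ))
    (p := f) (fun _ _ => by positivity) (by simp [hc.ne']) hf
  simp only [smul_eq_mul, ← Finset.mul_sum] at this
  calc ∑ i ∈ s, f i ^ β = s.card * (1 / (s.card : ℝ) * ∑ i ∈ s, f i ^ β) := by field_simp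
    _ ≤ _ := by gcongr

/-- Weighted AM-GM with weights `β` and `1 - β`, both at most one. It makes a variance of order `h ^
β` affordable by a penalty linear in `h`. -/
lemma rpow_mul_rpow_le_add {a y h β : ℝ} (ha : 0 ≤ a) (hy : 0 ≤ y) (hh : 0 ≤ h) (hβ0 : 0 ≤ β)
    (hβ1 : β ≤ 1) : a ^ β * h ^ β * y ^ (1 - β) ≤ a * h + y := by
  rw [← Real.mul_rpow ha hh]
  refine (Real.geom_mean_le_arith_mean2_weighted hβ0 (sub_nonneg.2 hβ1) (by positivity) hy
    (by ring)).trans ?_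
  have : 0 ≤ a * h := by positivity
  nlinarith

/-! ### Conditioning through regular conditional laws -/

section Disintegration

variable {Ω 𝒲 𝒴 : Type*} [MeasurableSpace Ω] [MeasurableSpace 𝒲] [MeasurableSpace 𝒴]
  [StandardBorelSpace 𝒴] [Nonempty 𝒴] {μ : Measure Ω} [IsFiniteMeasure μ]
  {W : Ω → 𝒲} {Y : Ω → 𝒴}

lemma ae_ae_condDistrib (hW : Measurable W) (hY : Measurable Y) {p : 𝒲 × 𝒴 → Prop}
    (hp : MeasurableSet {x | p x}) (h : ∀ᵐ ω ∂μ, p (W ω, Y ω)) :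
    ∀ᵐ ω ∂μ, ∀ᵐ y ∂condDistrib Y W μ (W ω), p (W ω, y) := by
  have h1 : ∀ᵐ x ∂μ.map (fun ω => (W ω, Y ω)), p x :=
    (ae_map_iff (hW.prodMk hY).aemeasurable hp).2 h
  rw [← compProd_map_condDistrib hY.aemeasurable] at h1
  exact ae_of_ae_map hW.aemeasurable (Measure.ae_ae_of_ae_compProd h1)

lemma lintegral_condDistrib (hW : Measurable W) (hY : Measurable Y) {f : 𝒲 × 𝒴 → ENNReal}
    (hf : Measurable f) :
    ∫⁻ ω, ∫⁻ y, f (W ω, y) ∂condDistrib Y W μ (W ω) ∂μ = ∫⁻ ω, f (W ω, Y ω) ∂μ := by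
  rw [← lintegral_map hf (hW.prodMk hY), ← compProd_map_condDistrib hY.aemeasurable,
    Measure.lintegral_compProd hf,
    lintegral_map (Measurable.lintegral_kernel_prod_right' hf) hW]

/-- One step of an exponential supermartingale. -/
lemma lintegral_mul_le_of_condDistrib (hW : Measurable W) (hY : Measurable Y)
    {F : Ω → ENNReal} (hF : Measurable[MeasurableSpace.comap W inferInstance] F)
    {g : 𝒲 × 𝒴 → ENNReal} (hg : Measurable g)
    (h : ∀ᵐ ω ∂μ, ∫⁻ y, g (W ω, y) ∂condDistrib Y W μ (W ω) ≤ 1) :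
    ∫⁻ ω, F ω * g (W ω, Y ω) ∂μ ≤ ∫⁻ ω, F ω ∂μ := by
  obtain ⟨Φ, hΦ, rfl⟩ := hF.exists_eq_measurable_comp
  have h1 := lintegral_condDistrib (μ := μ) hW hY
    (f := fun x => Φ x.1 * g x) ((hΦ.comp measurable_fst).mul hg)
  refine (le_of_eq h1.symm).trans ?_
  refine lintegral_mono_ae ?_
  filter_upwards [h] with ω hω
  rw [lintegral_const_mul _ (show Measurable fun y => g (W ω, y) from
    hg.comp measurable_prodMk_left)]
  exact mul_le_of_le_one_right' hω

/-- Conditional independence gives the product formula almost surely for each fixed pair of events.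
Countable generation of the target σ-fields yields one null set valid for all pairs, through almost
sure uniqueness of the disintegrating kernel. -/
lemma ae_indepFun_condDistrib (hW : Measurable W) (hY : Measurable Y) {𝒳₁ 𝒳₂ : Type*}
    [MeasurableSpace 𝒳₁] [MeasurableSpace 𝒳₂] [MeasurableSpace.CountablyGenerated 𝒳₁]
    [MeasurableSpace.CountablyGenerated 𝒳₂] {f : 𝒴 → 𝒳₁} {g : 𝒴 → 𝒳₂} (hf : Measurable f)
    (hg : Measurable g)
    (h : CondIndepGiven μ (MeasurableSpace.comap W inferInstance) (f ∘ Y) (g ∘ Y)) :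
    ∀ᵐ ω ∂μ, IndepFun f g (condDistrib Y W μ (W ω)) := by
  set κ := condDistrib Y W μ
  have h1 : Kernel.IndepFun f g κ (μ.map W) := by
    rw [Kernel.indepFun_iff_measure_inter_preimage_eq_mul]
    intro B C hB hC
    have hset : MeasurableSet {w | κ w (f ⁻¹' B ∩ g ⁻¹' C) = κ w (f ⁻¹' B) * κ w (g ⁻¹' C)} :=
      measurableSet_eq_fun (Kernel.measurable_coe _ ((hf hB).inter (hg hC)))
        ((Kernel.measurable_coe _ (hf hB)).mul (Kernel.measurable_coe _ (hg hC)))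
    rw [ae_map_iff hW.aemeasurable hset]
    have e1 := condDistrib_ae_eq_condExp (μ := μ) hW hY ((hf hB).inter (hg hC))
    have e2 := condDistrib_ae_eq_condExp (μ := μ) hW hY (hf hB)
    have e3 := condDistrib_ae_eq_condExp (μ := μ) hW hY (hg hC)
    filter_upwards [e1, e2, e3, h B C hB hC] with ω h1 h2 h3 h4
    have h5 : (κ (W ω)).real (f ⁻¹' B ∩ g ⁻¹' C) =
        (κ (W ω)).real (f ⁻¹' B) * (κ (W ω)).real (g ⁻¹' C) := by
      rw [h1, h2, h3]
      exact h4
    rw [measureReal_def, measureReal_def, measureReal_def, ← ENNReal.toReal_mul,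
      ENNReal.toReal_eq_toReal_iff' (measure_ne_top _ _)
        (ENNReal.mul_ne_top (measure_ne_top _ _) (measure_ne_top _ _))] at h5
    exact h5
  rw [Kernel.indepFun_iff_compProd_map_prod_eq_compProd_prod_map_map hf hg] at h1
  have h2 := ae_of_ae_map hW.aemeasurable (Kernel.ae_eq_of_compProd_eq h1)
  filter_upwards [h2] with ω hω
  rw [indepFun_iff_map_prod_eq_prod_map_map hf.aemeasurable hg.aemeasurable]
  rw [Kernel.map_apply _ (hf.prodMk hg), Kernel.prod_apply, Kernel.map_apply _ hf,
    Kernel.map_apply _ hg] at hω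
  exact hω

end Disintegration

/-- The conditional expectations of the sum of the `f α` given `m` is the sum of the conditional
expectations given the `m' α`. -/
structure SumCondExpAgree {Ω A : Type*} [Fintype A] (m : MeasurableSpace Ω)
    (m' : A → MeasurableSpace Ω) [MeasurableSpace Ω] (μ : Measure Ω) (f : A → Ω → ℝ) : Prop where
  integrable : ∀ α, Integrable (f α) μ
  agree : μ[fun ω => ∑ α, f α ω | m] =ᵐ[μ] fun ω => ∑ α, (μ[f α | m' α]) ω

namespace SumCondExpAgree

variable {Ω A : Type*} [Fintype A] {m : MeasurableSpace Ω}
  {m' : A → MeasurableSpace Ω} [MeasurableSpace Ω] {μ : Measure Ω} {f g : A → Ω → ℝ}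

lemma add (hf : SumCondExpAgree m m' μ f) (hg : SumCondExpAgree m m' μ g) :
    SumCondExpAgree m m' μ (fun α ω => f α ω + g α ω) where
  integrable α := (hf.integrable α).add (hg.integrable α)
  agree := by
    have e1 : (fun ω => ∑ α, (f α ω + g α ω)) =
        (fun ω => ∑ α, f α ω) + fun ω => ∑ α, g α ω := by
      ext ω; simp [Finset.sum_add_distrib]
    have e2 := condExp_add (μ := μ) (integrable_finsetSum Finset.univ fun α _ => hf.integrable α)
      (integrable_finsetSum Finset.univ fun α _ => hg.integrable α) m
    have e3 : ∀ᵐ ω ∂μ, ∀ α, (μ[fun ω => f α ω + g α ω | m' α]) ω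
        = (μ[f α | m' α]) ω + (μ[g α | m' α]) ω :=
      ae_all_iff.2 fun α => condExp_add (hf.integrable α) (hg.integrable α) (m' α)
    rw [e1]
    filter_upwards [e2, e3, hf.agree, hg.agree] with ω h2 h3 h4 h5
    rw [h2, Pi.add_apply, h4, h5, ← Finset.sum_add_distrib]
    exact Finset.sum_congr rfl fun α _ => (h3 α).symm

lemma const_mul (hf : SumCondExpAgree m m' μ f) (c : ℝ) :
    SumCondExpAgree m m' μ (fun α ω => c * f α ω) where
  integrable α := (hf.integrable α).const_mul c
  agree := by
    have e1 : (fun ω => ∑ α, c * f α ω) = c • (fun ω => ∑ α, f α ω) := by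
      ext ω; simp [Finset.mul_sum]
    have e2 := condExp_smul (μ := μ) c (fun ω => ∑ α, f α ω) m
    have e3 : ∀ᵐ ω ∂μ, ∀ α, (μ[fun ω => c * f α ω | m' α]) ω = c * (μ[f α | m' α]) ω :=
      ae_all_iff.2 fun α => condExp_smul c (f α) (m' α)
    rw [e1]
    filter_upwards [e2, e3, hf.agree] with ω h2 h3 h4
    rw [h2, Pi.smul_apply, h4, smul_eq_mul, Finset.mul_sum]
    exact Finset.sum_congr rfl fun α _ => (h3 α).symm

end SumCondExpAgree

/-! ### Exponential moments of averages over a slice -/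

section Averages

variable {Ω A : Type*} [Fintype A] [MeasurableSpace Ω] {P : Measure Ω}

/-- The average over `α` of the `x α`. -/
noncomputable def average (x : A → ℝ) : ℝ := (1 / (Fintype.card A : ℝ)) * ∑ α, x α

lemma average_sub (x y : A → ℝ) : average (fun α => x α - y α) = average x - average y := by
  simp [average, Finset.sum_sub_distrib, mul_sub]

lemma abs_average_le [Nonempty A] {x : A → ℝ} {b : ℝ} (h : ∀ α, |x α| ≤ b) : |average x| ≤ b := by
  have hA : (0 : ℝ) < Fintype.card A := by exact_mod_cast Fintype.card_pos
  rw [average, abs_mul, abs_of_pos (by positivity : (0 : ℝ) < 1 / (Fintype.card A : ℝ)),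
    one_div_mul_eq_div, div_le_iff₀ hA]
  calc |∑ α, x α| ≤ ∑ α, |x α| := Finset.abs_sum_le_sum_abs _ _
    _ ≤ ∑ _α : A, b := Finset.sum_le_sum fun α _ => h α
    _ = b * Fintype.card A := by simp [mul_comm]

lemma average_sq_le [Nonempty A] (x : A → ℝ) : average x ^ 2 ≤ average fun α => x α ^ 2 := by
  have hA : (0 : ℝ) < Fintype.card A := by exact_mod_cast Fintype.card_pos
  have h := sq_sum_le_card_mul_sum_sq (s := Finset.univ) (f := x)
  rw [Finset.card_univ] at h
  calc average x ^ 2 = (1 / (Fintype.card A : ℝ)) ^ 2 * (∑ α, x α) ^ 2 := by rw [average, mul_pow]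
    _ ≤ (1 / (Fintype.card A : ℝ)) ^ 2 * (Fintype.card A * ∑ α, x α ^ 2) := by gcongr
    _ = average fun α => x α ^ 2 := by rw [average]; field_simp

lemma measurable_average {X : A → Ω → ℝ} (hX : ∀ α, Measurable (X α)) :
    Measurable fun ω => average fun α => X α ω := by
  unfold average; fun_prop

lemma integral_average {X : A → Ω → ℝ} (hX : ∀ α, Integrable (X α) P) :
    ∫ ω, average (fun α => X α ω) ∂P = average fun α => ∫ ω, X α ω ∂P := by
  simp only [average]
  rw [integral_const_mul, integral_finsetSum _ fun α _ => hX α]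

variable [IsProbabilityMeasure P]

lemma integral_sq_sub_integral_le {X : Ω → ℝ} (hX : Measurable X) :
    ∫ ω, (X ω - ∫ ω', X ω' ∂P) ^ 2 ∂P ≤ ∫ ω, X ω ^ 2 ∂P := by
  rw [← variance_eq_integral hX.aemeasurable]
  exact variance_le_expectation_sq hX.aestronglyMeasurable

/-- Moment generating function of a centered average, without any independence. -/
lemma mgf_average_le [Nonempty A] {X : A → Ω → ℝ} (hX : ∀ α, Measurable (X α)) {B : ℝ}
    (hB : ∀ α ω, |X α ω| ≤ B) {b V u : ℝ}
    (hb : ∀ᵐ ω ∂P, |average (fun α => X α ω) - average fun α => ∫ ω', X α ω' ∂P| ≤ b)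
    (hV : average (fun α => ∫ ω, X α ω ^ 2 ∂P) ≤ V) (hu : |u| * b < 3) :
    mgf (fun ω => average (fun α => X α ω) - average fun α => ∫ ω', X α ω' ∂P) P u ≤
      Real.exp (u ^ 2 * V / (2 * (1 - |u| * b / 3))) := by
  have hi : ∀ α, Integrable (X α) P := fun α =>
    integrable_of_ae_abs_le (hX α) (.of_forall (hB α))
  have hi2 : ∀ α, Integrable (fun ω => X α ω ^ 2) P := fun α =>
    integrable_of_ae_abs_le (b := B ^ 2) ((hX α).pow_const 2) (.of_forall fun ω => by
      rw [abs_pow]; have := hB α ω; gcongr)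
  have hm := measurable_average hX
  have hia : Integrable (fun ω => average fun α => X α ω) P :=
    integrable_of_ae_abs_le hm (.of_forall fun ω => abs_average_le fun α => hB α ω)
  have hia2 : Integrable (fun ω => average fun α => X α ω ^ 2) P := by
    unfold average
    exact (integrable_finsetSum _ fun α _ => hi2 α).const_mul _
  rw [← integral_average hi] at hb ⊢
  refine (mgf_le_bernstein (hm.sub_const _) hb ?_ hu).trans ?_
  · rw [integral_sub hia (integrable_const _)]; simp
  · apply Real.exp_le_exp.2
    have : ∫ ω, (average (fun α => X α ω) - ∫ ω', average (fun α => X α ω') ∂P) ^ 2 ∂P ≤ V := by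
      refine (integral_sq_sub_integral_le hm).trans (le_trans ?_ hV)
      rw [← integral_average hi2]
      refine integral_mono ?_ hia2 fun ω => average_sq_le _
      exact integrable_of_ae_abs_le (b := B ^ 2) (hm.pow_const 2) (.of_forall fun ω => by
        rw [abs_pow]; have := abs_average_le fun α => hB α ω; gcongr)
    have hk : 0 < 2 * (1 - |u| * b / 3) := by linarith
    gcongr

/-- Moment generating function of a centered average with a dependency graph. -/
lemma mgf_average_le_of_dependencyGraph [Nonempty A] (G : SimpleGraph A) [DecidableRel G.Adj]
    {X : A → Ω → ℝ} (hX : ∀ α, Measurable (X α)) {B : ℝ}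
    (hB : ∀ α ω, |X α ω| ≤ B) {b V u : ℝ} (hb0 : 0 ≤ b)
    (hb : ∀ α, ∀ᵐ ω ∂P, |X α ω - ∫ ω', X α ω' ∂P| ≤ b)
    (hV : average (fun α => ∫ ω, X α ω ^ 2 ∂P) ≤ V)
    (hind : ∀ (α : A) (I : Finset A), α ∉ I → (∀ α' ∈ I, ¬ G.Adj α α') →
      IndepFun (X α) (fun ω => fun i : I => X i ω) P)
    (hu : 2 * |u| * b < 3 * ratio G) :
    mgf (fun ω => average (fun α => X α ω) - average fun α => ∫ ω', X α ω' ∂P) P u ≤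
      Real.exp (u ^ 2 * V / (2 * ratio G * (1 - 2 * |u| * b / (3 * ratio G)))) := by
  have hA : (0 : ℝ) < Fintype.card A := by exact_mod_cast Fintype.card_pos
  have hg : 0 < graphDeg G := by unfold graphDeg; positivity
  have hr : 0 < ratio G := div_pos hA hg
  have hrg : ratio G = Fintype.card A / graphDeg G := rfl
  have hi : ∀ α, Integrable (X α) P := fun α =>
    integrable_of_ae_abs_le (hX α) (.of_forall (hB α))
  set Y : A → Ω → ℝ := fun α ω => X α ω - ∫ ω', X α ω' ∂P with hYdef
  have hindY : ∀ (α : A) (I : Finset A), α ∉ I → (∀ α' ∈ I, ¬ G.Adj α α') →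
      IndepFun (Y α) (fun ω => ∑ i ∈ I, Y i ω) P := fun α I h h' => by
    have := (hind α I h h').comp (φ := fun x : ℝ => x - ∫ ω', X α ω' ∂P)
      (ψ := fun x : I → ℝ => ∑ i : I, (x i - ∫ ω', X i ω' ∂P)) (by fun_prop) (by fun_prop)
    have hs : (fun ω => ∑ i ∈ I, Y i ω) = (fun x : I → ℝ => ∑ i : I, (x i - ∫ ω', X i ω' ∂P)) ∘
        fun ω => fun i : I => X i ω := funext fun ω =>
      (Finset.sum_coe_sort I (fun i => X i ω - ∫ ω', X i ω' ∂P)).symm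
    rw [hs]
    exact this
  -- The average is the sum taken at parameter `u / |A|`, which turns the factor `graphDeg G` into
  -- `1 / ratio G`.
  have hstep : 2 * graphDeg G * |u / Fintype.card A| * b = 2 * |u| * b / ratio G := by
    rw [abs_div, abs_of_pos hA, hrg]; field_simp
  have hu' : 2 * graphDeg G * |u / Fintype.card A| * b < 3 := by
    rw [hstep, div_lt_iff₀ hr]; exact hu
  have h := mgf_sum_le_of_dependencyGraph (P := P) G (Y := Y) (fun α => (hX α).sub_const _) hb0 hb
    (fun α => by rw [integral_sub (hi α) (integrable_const _)]; simp) hindY hu'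
  have hmgf : mgf (fun ω => average (fun α => X α ω) - average fun α => ∫ ω', X α ω' ∂P) P u =
      mgf (fun ω => ∑ α, Y α ω) P (u / Fintype.card A) := by
    simp only [mgf, ← average_sub]
    refine integral_congr_ae (.of_forall fun ω => ?_)
    change Real.exp (u * (1 / (Fintype.card A : ℝ) * ∑ α, Y α ω)) =
      Real.exp (u / Fintype.card A * ∑ α, Y α ω)
    congr 1; ring
  rw [hmgf]
  refine h.trans (Real.exp_le_exp.2 ?_)
  have hS : ∑ α, ∫ ω, Y α ω ^ 2 ∂P ≤ Fintype.card A * V := by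
    calc ∑ α, ∫ ω, Y α ω ^ 2 ∂P ≤ ∑ α, ∫ ω, X α ω ^ 2 ∂P :=
          Finset.sum_le_sum fun α _ => integral_sq_sub_integral_le (hX α)
      _ = Fintype.card A * average (fun α => ∫ ω, X α ω ^ 2 ∂P) := by
          rw [average]; field_simp
      _ ≤ _ := by gcongr
  have hk : 0 < 1 - 2 * |u| * b / (3 * ratio G) := by
    rw [sub_pos, div_lt_one (by positivity)]; exact hu
  have hk2 : 1 - 2 * graphDeg G * |u / Fintype.card A| * b / 3 =
      1 - 2 * |u| * b / (3 * ratio G) := by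
    rw [hstep, div_div, mul_comm (ratio G)]
  rw [hk2]
  calc (u / Fintype.card A) ^ 2 * graphDeg G * (∑ α, ∫ ω, Y α ω ^ 2 ∂P) /
        (2 * (1 - 2 * |u| * b / (3 * ratio G)))
      ≤ (u / Fintype.card A) ^ 2 * graphDeg G * (Fintype.card A * V) /
        (2 * (1 - 2 * |u| * b / (3 * ratio G))) := by gcongr
    _ = _ := by
      generalize 1 - 2 * |u| * b / (3 * ratio G) = k at hk
      rw [hrg]; field_simp

end Averages

/-! ### Conditional moments and sub-gamma deviations in one slice -/

section Slices

variable {Ω A 𝒪 𝒵 Θ : Type*} [MeasurableSpace Ω] [MeasurableSpace 𝒪] [MeasurableSpace 𝒵]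
  [MeasurableSpace Θ]

/-- The excess loss in the slice `s` as a function of the conditioning information and of the
slice. -/
def excessAt (ℓ : Θ → 𝒪 → 𝒵 → ℝ) (θo : Θ) (alg : Algorithm A 𝒪 Θ) (s : ℕ) (α : A)
    (p : ((A → 𝒵) × (Fin s → A → 𝒪)) × (A → 𝒪)) : ℝ :=
  excessLoss ℓ θo (alg s p.1.2) (p.2 α) (p.1.1 α)

lemma measurable_excessLoss {ℓ : Θ → 𝒪 → 𝒵 → ℝ}
    (hℓ : Measurable (fun p : Θ × 𝒪 × 𝒵 => ℓ p.1 p.2.1 p.2.2)) (θo : Θ) :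
    Measurable fun p : Θ × 𝒪 × 𝒵 => excessLoss ℓ θo p.1 p.2.1 p.2.2 :=
  hℓ.sub (hℓ.comp (measurable_const.prodMk measurable_snd))

lemma measurable_excessAt {ℓ : Θ → 𝒪 → 𝒵 → ℝ}
    (hℓ : Measurable (fun p : Θ × 𝒪 × 𝒵 => ℓ p.1 p.2.1 p.2.2)) (θo : Θ)
    {alg : Algorithm A 𝒪 Θ} (halg : ∀ s, Measurable (alg s)) (s : ℕ) (α : A) :
    Measurable (excessAt (𝒵 := 𝒵) ℓ θo alg s α) := by
  have := halg s
  exact (measurable_excessLoss hℓ θo).comp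
    (f := fun p : ((A → 𝒵) × (Fin s → A → 𝒪)) × (A → 𝒪) => (alg s p.1.2, p.2 α, p.1.1 α))
    (by fun_prop)

lemma measurable_slice {O : ℕ → A → Ω → 𝒪} (hO : ∀ s α, Measurable (O s α)) (s : ℕ) :
    Measurable (slice O s) := measurable_pi_lambda _ fun α => hO s α

lemma measurable_history {O : ℕ → A → Ω → 𝒪} (hO : ∀ s α, Measurable (O s α)) (s : ℕ) :
    Measurable (history O s) :=
  measurable_pi_lambda _ fun i => measurable_pi_lambda _ fun α => hO i α

lemma measurable_sliceInfo {Summ : (A → 𝒪) → A → 𝒵} (hSumm : Measurable Summ)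
    {O : ℕ → A → Ω → 𝒪} (hO : ∀ s α, Measurable (O s α)) (s : ℕ) :
    Measurable (sliceInfo Summ O s) :=
  (hSumm.comp (measurable_slice hO s)).prodMk (measurable_history hO s)

lemma measurable_localInfo {Summ : (A → 𝒪) → A → 𝒵} (hSumm : Measurable Summ)
    {O : ℕ → A → Ω → 𝒪} (hO : ∀ s α, Measurable (O s α)) (s : ℕ) (α : A) :
    Measurable (localInfo Summ O s α) :=
  ((measurable_pi_apply α).comp (hSumm.comp (measurable_slice hO s))).prodMk
    (measurable_history hO s)

/-- The conditional first and second moments of the excess loss agree, in sum over `α`, given the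
whole summary and the `α`-specific ones. -/
lemma SharedRisk.excess_agree [Fintype A] {μ : Measure Ω} [IsProbabilityMeasure μ]
    {ℓ : Θ → 𝒪 → 𝒵 → ℝ} {Summ : (A → 𝒪) → A → 𝒵} {O : ℕ → A → Ω → 𝒪} {θo : Θ}
    {alg : Algorithm A 𝒪 Θ} {θstar : Θ} (h1 : SharedRisk μ ℓ Summ O θstar)
    (hℓ : Measurable (fun p : Θ × 𝒪 × 𝒵 => ℓ p.1 p.2.1 p.2.2))
    (halg : ∀ s, Measurable (alg s)) (hO : ∀ s α, Measurable (O s α)) (hSumm : Measurable Summ)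
    {b₁ : ℝ} (hb₁ : ∀ θ o z, |excessLoss ℓ θo θ o z| ≤ b₁) (s : ℕ) :
    SumCondExpAgree (sliceSigma Summ O s) (localSigma Summ O s) μ
        (fun α ω => excessAt ℓ θo alg s α (sliceInfo Summ O s ω, slice O s ω)) ∧
      SumCondExpAgree (sliceSigma Summ O s) (localSigma Summ O s) μ
        (fun α ω => excessAt ℓ θo alg s α (sliceInfo Summ O s ω, slice O s ω) ^ 2) := by
  set X : A → Ω → ℝ := fun α ω => excessAt ℓ θo alg s α (sliceInfo Summ O s ω, slice O s ω)
  set L : A → Ω → ℝ := lossAt ℓ Summ O (learned alg O s) s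
  set L0 : A → Ω → ℝ := lossAt ℓ Summ O (fun _ => θo) s
  have hXL : ∀ α ω, X α ω = L α ω - L0 α ω := fun α ω => rfl
  have hXm : ∀ α, Measurable (X α) := fun α => (measurable_excessAt hℓ θo halg s α).comp
    ((measurable_sliceInfo hSumm hO s).prodMk (measurable_slice hO s))
  have hX : ∀ α, MemLp (X α) 2 μ := fun α =>
    .of_bound (hXm α).aestronglyMeasurable b₁ (.of_forall fun ω => hb₁ _ _ _)
  have hL0 : ∀ α, MemLp (L0 α) 2 μ := fun α => h1.sq_integrable θo s α
  -- Square-integrability is assumed for fixed parameters only. The loss at the learned parameter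
  -- inherits it because it differs from the loss at `θo` by a bounded variable.
  have hL : ∀ α, MemLp (L α) 2 μ := fun α => by
    have : L α = X α + L0 α := by ext ω; simp [hXL]
    rw [this]; exact (hX α).add (hL0 α)
  have hη : Measurable[pastSigma O s] (learned alg O s) :=
    (halg s).comp (comap_measurable (history O s))
  -- The agreement of moments is assumed for monomials in the two losses; expanding the excess loss
  -- and its square uses exactly the five nonconstant monomials of degree at most two.
  have key : ∀ ε₁ ε₂ : ℕ, ε₁ + ε₂ ≤ 2 →
      (∀ α, Integrable (fun ω => L α ω ^ ε₁ * L0 α ω ^ ε₂) μ) →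
      SumCondExpAgree (sliceSigma Summ O s) (localSigma Summ O s) μ
        (fun α ω => L α ω ^ ε₁ * L0 α ω ^ ε₂) := fun ε₁ ε₂ hε hi =>
    ⟨hi, h1.moments θo s _ hη ε₁ ε₂ hε⟩
  have k10 := key 1 0 (by norm_num) fun α => by simpa using (hL α).integrable one_le_two
  have k01 := key 0 1 (by norm_num) fun α => by simpa using (hL0 α).integrable one_le_two
  have k20 := key 2 0 (by norm_num) fun α => by simpa using (hL α).integrable_sq
  have k02 := key 0 2 (by norm_num) fun α => by simpa using (hL0 α).integrable_sq
  have k11 := key 1 1 (by norm_num) fun α => by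
    simp only [pow_one]
    exact (hL α).integrable_mul (hL0 α)
  constructor
  · convert k10.add (k01.const_mul (-1)) using 3 with α ω
    change L α ω - L0 α ω = _
    ring
  · convert (k20.add (k11.const_mul (-2))).add k02 using 3 with α ω
    change (L α ω - L0 α ω) ^ 2 = _
    ring

variable [Fintype A] [StandardBorelSpace 𝒪] [Nonempty 𝒪] (μ : Measure Ω) [IsProbabilityMeasure μ]

/-- The conditional law of the slice `s` given its summary and the past. -/
noncomputable abbrev sliceLaw (Summ : (A → 𝒪) → A → 𝒵) (O : ℕ → A → Ω → 𝒪) (s : ℕ) :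
    Kernel ((A → 𝒵) × (Fin s → A → 𝒪)) (A → 𝒪) :=
  condDistrib (slice O s) (sliceInfo Summ O s) μ

/-- The conditional excess risk in the slice `s`. -/
noncomputable def excessRisk (ℓ : Θ → 𝒪 → 𝒵 → ℝ) (Summ : (A → 𝒪) → A → 𝒵) (O : ℕ → A → Ω → 𝒪)
    (θo : Θ) (alg : Algorithm A 𝒪 Θ) (s : ℕ) (w : (A → 𝒵) × (Fin s → A → 𝒪)) : ℝ :=
  average fun α => ∫ o, excessAt ℓ θo alg s α (w, o) ∂sliceLaw μ Summ O s w

/-- The average excess loss in the slice `s` minus the conditional excess risk. -/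
noncomputable def deviation (ℓ : Θ → 𝒪 → 𝒵 → ℝ) (Summ : (A → 𝒪) → A → 𝒵) (O : ℕ → A → Ω → 𝒪)
    (θo : Θ) (alg : Algorithm A 𝒪 Θ) (s : ℕ) (p : ((A → 𝒵) × (Fin s → A → 𝒪)) × (A → 𝒪)) : ℝ :=
  average (fun α => excessAt ℓ θo alg s α p) - excessRisk μ ℓ Summ O θo alg s p.1

variable {μ} {ℓ : Θ → 𝒪 → 𝒵 → ℝ} {Summ : (A → 𝒪) → A → 𝒵} {O : ℕ → A → Ω → 𝒪} {θo : Θ}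
  {alg : Algorithm A 𝒪 Θ}

lemma measurable_excessRisk (hℓ : Measurable (fun p : Θ × 𝒪 × 𝒵 => ℓ p.1 p.2.1 p.2.2))
    (halg : ∀ s, Measurable (alg s)) (s : ℕ) :
    Measurable (excessRisk μ ℓ Summ O θo alg s) :=
  measurable_average fun α =>
    (measurable_excessAt hℓ θo halg s α).stronglyMeasurable.integral_condDistrib.measurable

lemma measurable_deviation (hℓ : Measurable (fun p : Θ × 𝒪 × 𝒵 => ℓ p.1 p.2.1 p.2.2))
    (halg : ∀ s, Measurable (alg s)) (s : ℕ) :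
    Measurable (deviation μ ℓ Summ O θo alg s) :=
  (measurable_average fun α => measurable_excessAt hℓ θo halg s α).sub
    ((measurable_excessRisk hℓ halg s).comp measurable_fst)

/-- Almost sure bounds in the slice `s` under the conditional law of the slice. -/
lemma ae_slice_bounds [Nonempty A] (hℓ : Measurable (fun p : Θ × 𝒪 × 𝒵 => ℓ p.1 p.2.1 p.2.2))
    (halg : ∀ s, Measurable (alg s)) (hO : ∀ s α, Measurable (O s α)) (hSumm : Measurable Summ)
    {θstar : Θ} (h1 : SharedRisk μ ℓ Summ O θstar) {b₁ b₂ : ℝ}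
    (h2 : BoundedLoss μ ℓ Summ O θo b₁ b₂) {β γ : ℝ} (h3 : VarianceBound μ ℓ Summ O θo β γ)
    (s : ℕ) :
    ∀ᵐ ω ∂μ, 0 ≤ excessRisk μ ℓ Summ O θo alg s (sliceInfo Summ O s ω) ∧
      average (fun α => ∫ o, excessAt ℓ θo alg s α (sliceInfo Summ O s ω, o) ^ 2
        ∂sliceLaw μ Summ O s (sliceInfo Summ O s ω)) ≤
          γ * excessRisk μ ℓ Summ O θo alg s (sliceInfo Summ O s ω) ^ β ∧
      (∀ᵐ o ∂sliceLaw μ Summ O s (sliceInfo Summ O s ω),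
        |deviation μ ℓ Summ O θo alg s (sliceInfo Summ O s ω, o)| ≤ b₂) ∧
      ∀ α, ∀ᵐ o ∂sliceLaw μ Summ O s (sliceInfo Summ O s ω),
        |excessAt ℓ θo alg s α (sliceInfo Summ O s ω, o) -
          ∫ o', excessAt ℓ θo alg s α (sliceInfo Summ O s ω, o')
            ∂sliceLaw μ Summ O s (sliceInfo Summ O s ω)| ≤ 2 * b₂ := by
  have hA : (0 : ℝ) < Fintype.card A := by exact_mod_cast Fintype.card_pos
  have hW := measurable_sliceInfo hSumm hO s
  have hU := measurable_slice hO s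
  have hxm := fun α => measurable_excessAt (𝒵 := 𝒵) hℓ θo halg s α
  have hxb : ∀ α p, |excessAt ℓ θo alg s α p| ≤ b₁ := fun α p => h2.sup_le _ _ _
  obtain ⟨ag1, ag2⟩ := h1.excess_agree hℓ halg hO hSumm h2.sup_le s
  -- conditional moments given the whole summary
  have c1 := condExp_prod_ae_eq_integral_condDistrib (μ := μ) hW hU.aemeasurable
    (f := fun p => ∑ α, excessAt ℓ θo alg s α p)
    (Finset.measurable_sum _ fun α _ => hxm α).stronglyMeasurable
    (integrable_finsetSum _ fun α _ => ag1.integrable α)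
  have c2 := condExp_prod_ae_eq_integral_condDistrib (μ := μ) hW hU.aemeasurable
    (f := fun p => ∑ α, excessAt ℓ θo alg s α p ^ 2)
    (Finset.measurable_sum _ fun α _ => (hxm α).pow_const 2).stronglyMeasurable
    (integrable_finsetSum _ fun α _ => ag2.integrable α)
  -- conditional moments given the local summaries
  let loc : A → (𝒵 × (Fin s → A → 𝒪)) × 𝒪 → ℝ := fun _ p =>
    excessLoss ℓ θo (alg s p.1.2) p.2 p.1.1
  have hloc : ∀ α, Measurable (loc α) := fun α => by
    have := halg s
    exact (measurable_excessLoss hℓ θo).comp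
      (f := fun p : (𝒵 × (Fin s → A → 𝒪)) × 𝒪 => (alg s p.1.2, p.2, p.1.1)) (by fun_prop)
  let mt : A → (A → 𝒵) × (Fin s → A → 𝒪) → ℝ := fun α w =>
    ∫ o, loc α ((w.1 α, w.2), o) ∂condDistrib (O s α) (localInfo Summ O s α) μ (w.1 α, w.2)
  have hmt : ∀ α, Measurable (mt α) := fun α =>
    ((hloc α).stronglyMeasurable.integral_condDistrib
      (Y := O s α) (X := localInfo Summ O s α) (μ := μ)).measurable.comp
      (f := fun w : (A → 𝒵) × (Fin s → A → 𝒪) => (w.1 α, w.2)) (by fun_prop)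
  have l1 : ∀ᵐ ω ∂μ, ∀ α, (μ[fun ω => excessAt ℓ θo alg s α (sliceInfo Summ O s ω, slice O s ω) |
      localSigma Summ O s α]) ω = mt α (sliceInfo Summ O s ω) :=
    ae_all_iff.2 fun α => condExp_prod_ae_eq_integral_condDistrib (μ := μ)
      (measurable_localInfo hSumm hO s α) (hO s α).aemeasurable
      (hloc α).stronglyMeasurable (ag1.integrable α)
  have l2 : ∀ᵐ ω ∂μ, ∀ α,
      (μ[fun ω => excessAt ℓ θo alg s α (sliceInfo Summ O s ω, slice O s ω) ^ 2 |
      localSigma Summ O s α]) ω = condMean μ Summ O s α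
        (fun o z => excessLoss ℓ θo (learned alg O s ω) o z ^ 2) ω :=
    ae_all_iff.2 fun α => condExp_prod_ae_eq_integral_condDistrib (μ := μ)
      (measurable_localInfo hSumm hO s α) (hO s α).aemeasurable
      (f := fun p => loc α p ^ 2)
      ((hloc α).pow_const 2).stronglyMeasurable (ag2.integrable α)
  have hcen : ∀ᵐ ω ∂μ, ∀ᵐ o ∂sliceLaw μ Summ O s (sliceInfo Summ O s ω), ∀ α,
      |excessAt ℓ θo alg s α (sliceInfo Summ O s ω, o) - mt α (sliceInfo Summ O s ω)| ≤ b₂ := by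
    refine ae_ae_condDistrib (μ := μ) hW hU
      (p := fun x => ∀ α, |excessAt ℓ θo alg s α x - mt α x.1| ≤ b₂) ?_ ?_
    · simp only [Set.ofPred_forall]
      exact MeasurableSet.iInter fun α => measurableSet_le
        (((hxm α).sub ((hmt α).comp measurable_fst)).abs) measurable_const
    · filter_upwards [h2.centered_le] with ω hω α using hω s α (learned alg O s ω)
  filter_upwards [c1, c2, l1, l2, ag1.agree, ag2.agree, hcen, h3.bound] with
    ω c1 c2 l1 l2 a1 a2 hcen h3b
  set w := sliceInfo Summ O s ω with hw
  have hxmw : ∀ α, Measurable fun o => excessAt ℓ θo alg s α (w, o) := fun α =>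
    (hxm α).comp measurable_prodMk_left
  have hxi : ∀ α, Integrable (fun o => excessAt ℓ θo alg s α (w, o)) (sliceLaw μ Summ O s w) :=
    fun α => integrable_of_ae_abs_le (hxmw α) (.of_forall fun o => hxb α _)
  have hxi2 : ∀ α, Integrable (fun o => excessAt ℓ θo alg s α (w, o) ^ 2)
      (sliceLaw μ Summ O s w) := fun α =>
    integrable_of_ae_abs_le (b := b₁ ^ 2) ((hxmw α).pow_const 2) (.of_forall fun o => by
      rw [abs_pow]; have := hxb α (w, o); gcongr)
  have hsum1 : ∑ α, ∫ o, excessAt ℓ θo alg s α (w, o) ∂sliceLaw μ Summ O s w =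
      ∑ α, mt α w := by
    rw [← integral_finsetSum _ fun α _ => hxi α, ← c1, a1]
    exact Finset.sum_congr rfl fun α _ => l1 α
  -- The means given the whole summary and the local ones agree only after averaging over `α`. Hence
  -- the averaged deviation keeps the bound `b₂`, while individual terms do not.
  have hrisk : excessRisk μ ℓ Summ O θo alg s w = average fun α => mt α w := by
    simp only [excessRisk, average, hsum1]
  have hpos : ∀ α, 0 ≤ mt α w := fun α => (h3b s α (learned alg O s ω)).1
  refine ⟨?_, ?_, ?_, fun α => ?_⟩
  · rw [hrisk, average]
    have := Finset.sum_nonneg fun α (_ : α ∈ Finset.univ) => hpos α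
    positivity
  · have hsq : ∑ α, ∫ o, excessAt ℓ θo alg s α (w, o) ^ 2 ∂sliceLaw μ Summ O s w ≤
        ∑ α, γ * mt α w ^ β := by
      rw [← integral_finsetSum _ fun α _ => hxi2 α, ← c2, a2]
      refine Finset.sum_le_sum fun α _ => ?_
      rw [l2 α]
      exact (h3b s α (learned alg O s ω)).2
    rw [← Finset.mul_sum] at hsq
    have hJ := sum_rpow_le_card_mul Finset.univ Finset.univ_nonempty (f := fun α => mt α w)
      (fun α _ => hpos α) h3.β_pos.le h3.β_le
    rw [Finset.card_univ] at hJ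
    have hγ := h3.γ_pos
    rw [hrisk]
    calc average (fun α => ∫ o, excessAt ℓ θo alg s α (w, o) ^ 2 ∂sliceLaw μ Summ O s w)
        ≤ 1 / (Fintype.card A : ℝ) * (γ * (Fintype.card A * (average fun α => mt α w) ^ β)) := by
          rw [average]
          gcongr
          exact hsq.trans (mul_le_mul_of_nonneg_left hJ hγ.le)
      _ = _ := by field_simp
  · filter_upwards [hcen] with o ho
    rw [deviation, hrisk, ← average_sub]
    exact abs_average_le ho
  · have h5 : ∀ᵐ o ∂sliceLaw μ Summ O s w, |excessAt ℓ θo alg s α (w, o) - mt α w| ≤ b₂ := by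
      filter_upwards [hcen] with o ho using ho α
    -- Recentering an individual term from its local mean to its mean under the slice law costs a
    -- second `b₂`.
    have h6 : |(∫ o', excessAt ℓ θo alg s α (w, o') ∂sliceLaw μ Summ O s w) - mt α w| ≤ b₂ := by
      have := norm_integral_le_of_norm_le_const (f := fun o => excessAt ℓ θo alg s α (w, o) - mt α w)
        (C := b₂) h5
      rw [integral_sub (hxi α) (integrable_const _)] at this
      simpa using this
    filter_upwards [h5] with o ho
    rw [abs_le] at ho h6 ⊢
    constructor <;> linarith [ho.1, ho.2, h6.1, h6.2]

/-- The property that, given the summary of the slice and the past, the deviation in each slice is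
sub-gamma with variance factor proportional to a power of the excess risk. -/
def HasSubgammaDeviations (μ : Measure Ω) [IsProbabilityMeasure μ] (ℓ : Θ → 𝒪 → 𝒵 → ℝ)
    (Summ : (A → 𝒪) → A → 𝒵) (O : ℕ → A → Ω → 𝒪) (θo : Θ) (alg : Algorithm A 𝒪 Θ)
    (b β γ ρ : ℝ) : Prop :=
  ∀ s, ∀ᵐ ω ∂μ, ∀ u : ℝ, |u| * b < 3 * ρ →
    mgf (fun o => deviation μ ℓ Summ O θo alg s (sliceInfo Summ O s ω, o))
        (sliceLaw μ Summ O s (sliceInfo Summ O s ω)) u ≤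
      Real.exp (u ^ 2 * (γ * excessRisk μ ℓ Summ O θo alg s (sliceInfo Summ O s ω) ^ β) /
        (2 * ρ * (1 - |u| * b / (3 * ρ))))

/-- Bernstein applied to the whole average: its variance is at most the average of the second
moments, whatever the dependence between the `α`. -/
lemma hasSubgammaDeviations_one [Nonempty A]
    (hℓ : Measurable (fun p : Θ × 𝒪 × 𝒵 => ℓ p.1 p.2.1 p.2.2))
    (halg : ∀ s, Measurable (alg s)) (hO : ∀ s α, Measurable (O s α)) (hSumm : Measurable Summ)
    {θstar : Θ} (h1 : SharedRisk μ ℓ Summ O θstar) {b₁ b₂ : ℝ}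
    (h2 : BoundedLoss μ ℓ Summ O θo b₁ b₂) {β γ : ℝ} (h3 : VarianceBound μ ℓ Summ O θo β γ) :
    HasSubgammaDeviations μ ℓ Summ O θo alg b₂ β γ 1 := by
  intro s
  filter_upwards [ae_slice_bounds hℓ halg hO hSumm h1 h2 h3 s] with ω ⟨_, hV, hb, _⟩ u hu
  have := mgf_average_le (P := sliceLaw μ Summ O s (sliceInfo Summ O s ω))
    (fun α => (measurable_excessAt hℓ θo halg s α).comp measurable_prodMk_left)
    (fun α o => h2.sup_le _ _ _) hb hV (by linarith : |u| * b₂ < 3)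
  simp only [mul_one]
  exact this

/-- The quarter combines the factor 2 from the weights of the color classes with the factor 2 from
recentering each term. Both concern the range only; the variance term is weakened to have the same
`ρ`. -/
lemma hasSubgammaDeviations_ratio [Nonempty A]
    (hℓ : Measurable (fun p : Θ × 𝒪 × 𝒵 => ℓ p.1 p.2.1 p.2.2))
    (halg : ∀ s, Measurable (alg s)) (hO : ∀ s α, Measurable (O s α)) (hSumm : Measurable Summ)
    (G : SimpleGraph A) [DecidableRel G.Adj] (h0 : DependencyGraph μ Summ O G)
    {θstar : Θ} (h1 : SharedRisk μ ℓ Summ O θstar) {b₁ b₂ : ℝ}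
    (h2 : BoundedLoss μ ℓ Summ O θo b₁ b₂) {β γ : ℝ} (h3 : VarianceBound μ ℓ Summ O θo β γ) :
    HasSubgammaDeviations μ ℓ Summ O θo alg b₂ β γ (ratio G / 4) := by
  intro s
  have hr : 0 < ratio G := by
    have hA : (0 : ℝ) < Fintype.card A := by exact_mod_cast Fintype.card_pos
    have hg : 0 < graphDeg G := by unfold graphDeg; positivity
    exact div_pos hA hg
  have hγ := h3.γ_pos
  have hind : ∀ᵐ ω ∂μ, ∀ (α : A) (I : Finset A), α ∉ I → (∀ α' ∈ I, ¬ G.Adj α α') →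
      IndepFun (fun o : A → 𝒪 => o α) (fun o => fun i : I => o i)
        (sliceLaw μ Summ O s (sliceInfo Summ O s ω)) := by
    rw [ae_all_iff]; intro α
    rw [ae_all_iff]; intro I
    by_cases h : α ∉ I ∧ ∀ α' ∈ I, ¬ G.Adj α α'
    · have := ae_indepFun_condDistrib (measurable_sliceInfo hSumm hO s) (measurable_slice hO s)
        (f := fun o : A → 𝒪 => o α) (g := fun o : A → 𝒪 => fun i : I => o i)
        (by fun_prop) (by fun_prop) (h0 s α (I : Set A) (by simpa using h.1) (by simpa using h.2))
      filter_upwards [this] with ω hω _ _ using hω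
    · exact .of_forall fun ω h1 h2 => absurd ⟨h1, h2⟩ h
  filter_upwards [ae_slice_bounds hℓ halg hO hSumm h1 h2 h3 s, hind] with
    ω ⟨hpos, hV, _, hb⟩ hind u hu
  have hb₂ := h2.b₂_pos
  set w := sliceInfo Summ O s ω
  have hm : ∀ α, Measurable fun o => excessLoss ℓ θo (alg s w.2) o (w.1 α) := fun α =>
    (measurable_excessLoss hℓ θo).comp (measurable_const.prodMk (measurable_id.prodMk
      measurable_const))
  have := mgf_average_le_of_dependencyGraph (P := sliceLaw μ Summ O s w) G (u := u)
    (X := fun α o => excessAt ℓ θo alg s α (w, o))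
    (fun α => (measurable_excessAt hℓ θo halg s α).comp measurable_prodMk_left)
    (fun α o => h2.sup_le _ _ _) (by positivity) hb hV
    (fun α I h h' => (hind α I h h').comp
      (φ := fun x => excessLoss ℓ θo (alg s w.2) x (w.1 α))
      (ψ := fun (x : I → 𝒪) (i : I) => excessLoss ℓ θo (alg s w.2) (x i) (w.1 i))
      (hm α) (measurable_pi_lambda _ fun i => (hm i).comp (measurable_pi_apply i)))
    (by linarith)
  refine this.trans (Real.exp_le_exp.2 ?_)
  have hk : 0 < 1 - |u| * b₂ / (3 * (ratio G / 4)) := by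
    rw [sub_pos, div_lt_one (by positivity)]; exact hu
  have hk2 : 1 - 2 * |u| * (2 * b₂) / (3 * ratio G) = 1 - |u| * b₂ / (3 * (ratio G / 4)) := by
    field_simp; ring
  rw [hk2]
  have hN : 0 ≤ u ^ 2 * (γ * excessRisk μ ℓ Summ O θo alg s w ^ β) := by positivity
  apply div_le_div_of_nonneg_left hN (by positivity)
  gcongr
  linarith

end Slices

/-! ### The exponential supermartingale and deviation bounds over time -/

section Tails

variable {Ω A 𝒪 𝒵 Θ : Type*} [MeasurableSpace 𝒪] [MeasurableSpace 𝒵]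

/-- Earlier slices and their summaries are functions of the past. -/
lemma measurable_sliceInfo_slice_of_lt {Summ : (A → 𝒪) → A → 𝒵} (hSumm : Measurable Summ)
    (O : ℕ → A → Ω → 𝒪) {s n : ℕ} (hs : s < n) :
    Measurable[sliceSigma Summ O n] fun ω => (sliceInfo Summ O s ω, slice O s ω) := by
  have h : Measurable fun w : (A → 𝒵) × (Fin n → A → 𝒪) =>
      ((Summ (w.2 ⟨s, hs⟩), fun i : Fin s => w.2 ⟨i, i.2.trans hs⟩), w.2 ⟨s, hs⟩) := by
    have h1 : Measurable fun w : (A → 𝒵) × (Fin n → A → 𝒪) => w.2 ⟨s, hs⟩ := by fun_prop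
    exact ((hSumm.comp h1).prodMk (by fun_prop)).prodMk h1
  exact h.comp (comap_measurable (sliceInfo Summ O n))

variable [MeasurableSpace Ω] [MeasurableSpace Θ] [Fintype A] [StandardBorelSpace 𝒪] [Nonempty 𝒪]
  {μ : Measure Ω} [IsProbabilityMeasure μ]
  {ℓ : Θ → 𝒪 → 𝒵 → ℝ} {Summ : (A → 𝒪) → A → 𝒵} {O : ℕ → A → Ω → 𝒪} {θo : Θ}
  {alg : Algorithm A 𝒪 Θ}

/-- A product over time of factors with conditional means at most one has mean at most one. -/
lemma lintegral_prod_le_one (hO : ∀ s α, Measurable (O s α)) (hSumm : Measurable Summ)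
    {g : ∀ s, ((A → 𝒵) × (Fin s → A → 𝒪)) × (A → 𝒪) → ENNReal} (hg : ∀ s, Measurable (g s))
    (h : ∀ s, ∀ᵐ ω ∂μ, ∫⁻ o, g s (sliceInfo Summ O s ω, o)
      ∂sliceLaw μ Summ O s (sliceInfo Summ O s ω) ≤ 1) (t : ℕ) :
    ∫⁻ ω, ∏ s ∈ Finset.range t, g s (sliceInfo Summ O s ω, slice O s ω) ∂μ ≤ 1 := by
  induction t with
  | zero => simp
  | succ n ih =>
    simp only [Finset.prod_range_succ]
    refine (lintegral_mul_le_of_condDistrib (measurable_sliceInfo hSumm hO n)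
      (measurable_slice hO n) ?_ (hg n) (h n)).trans ih
    exact Finset.measurable_prod (m := sliceSigma Summ O n) _ fun s hs =>
      (hg s).comp (measurable_sliceInfo_slice_of_lt hSumm O (Finset.mem_range.1 hs))

/-- The average over time of the conditional excess risks. -/
noncomputable def cumRisk (μ : Measure Ω) [IsProbabilityMeasure μ] (ℓ : Θ → 𝒪 → 𝒵 → ℝ)
    (Summ : (A → 𝒪) → A → 𝒵) (O : ℕ → A → Ω → 𝒪) (θo : Θ) (alg : Algorithm A 𝒪 Θ) (t : ℕ)
    (ω : Ω) : ℝ :=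
  (1 / (t : ℝ)) * ∑ s ∈ Finset.range t, excessRisk μ ℓ Summ O θo alg s (sliceInfo Summ O s ω)

/-- The average over time of the deviations. -/
noncomputable def cumDeviation (μ : Measure Ω) [IsProbabilityMeasure μ] (ℓ : Θ → 𝒪 → 𝒵 → ℝ)
    (Summ : (A → 𝒪) → A → 𝒵) (O : ℕ → A → Ω → 𝒪) (θo : Θ) (alg : Algorithm A 𝒪 Θ) (t : ℕ)
    (ω : Ω) : ℝ :=
  (1 / (t : ℝ)) * ∑ s ∈ Finset.range t,
    deviation μ ℓ Summ O θo alg s (sliceInfo Summ O s ω, slice O s ω)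

/-- A Chernoff bound for the deviations penalized by the excess risk. -/
lemma measure_le_exp_of_subgamma [Nonempty A]
    (hℓ : Measurable (fun p : Θ × 𝒪 × 𝒵 => ℓ p.1 p.2.1 p.2.2))
    (halg : ∀ s, Measurable (alg s)) (hO : ∀ s α, Measurable (O s α)) (hSumm : Measurable Summ)
    {b₁ : ℝ} (hb₁ : ∀ θ o z, |excessLoss ℓ θo θ o z| ≤ b₁) {b β γ ρ : ℝ}
    (hdev : HasSubgammaDeviations μ ℓ Summ O θo alg b β γ ρ) {u : ℝ} (hu : |u| * b < 3 * ρ)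
    (t : ℕ) (E : ℝ) :
    μ.real {ω | E ≤ ∑ s ∈ Finset.range t,
      (u * deviation μ ℓ Summ O θo alg s (sliceInfo Summ O s ω, slice O s ω) -
        u ^ 2 * (γ * excessRisk μ ℓ Summ O θo alg s (sliceInfo Summ O s ω) ^ β) /
          (2 * ρ * (1 - |u| * b / (3 * ρ))))} ≤ Real.exp (-E) := by
  set ψ : ∀ s, (A → 𝒵) × (Fin s → A → 𝒪) → ℝ := fun s w =>
    u ^ 2 * (γ * excessRisk μ ℓ Summ O θo alg s w ^ β) / (2 * ρ * (1 - |u| * b / (3 * ρ))) with hψ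
  have hψm : ∀ s, Measurable (ψ s) := fun s => by
    have := measurable_excessRisk (μ := μ) (Summ := Summ) (O := O) (θo := θo) hℓ halg s
    fun_prop
  have hdm : ∀ s, Measurable (deviation μ ℓ Summ O θo alg s) := fun s =>
    measurable_deviation hℓ halg s
  let e : ∀ s, ((A → 𝒵) × (Fin s → A → 𝒪)) × (A → 𝒪) → ℝ := fun s p =>
    u * deviation μ ℓ Summ O θo alg s p - ψ s p.1
  have he : ∀ s, Measurable (e s) := fun s =>
    ((hdm s).const_mul u).sub ((hψm s).comp measurable_fst)
  -- A crude bound depending on `w`, enough for exponential integrability under the slice law.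
  have hdb : ∀ s w, ∃ c, ∀ o, |deviation μ ℓ Summ O θo alg s (w, o)| ≤ c := fun s w =>
    ⟨b₁ + |excessRisk μ ℓ Summ O θo alg s w|, fun o => (abs_sub _ _).trans (by
      gcongr
      exact abs_average_le fun α => hb₁ _ _ _)⟩
  have hstep : ∀ s, ∀ᵐ ω ∂μ, ∫⁻ o, ENNReal.ofReal (Real.exp (e s (sliceInfo Summ O s ω, o)))
      ∂sliceLaw μ Summ O s (sliceInfo Summ O s ω) ≤ 1 := fun s => by
    filter_upwards [hdev s] with ω hω
    set w := sliceInfo Summ O s ω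
    obtain ⟨c, hc⟩ := hdb s w
    have hint := integrable_exp_of_ae_abs_le (P := sliceLaw μ Summ O s w)
      (Y := fun o => deviation μ ℓ Summ O θo alg s (w, o))
      ((hdm s).comp measurable_prodMk_left) (.of_forall hc) u
    have heq : ∀ o, Real.exp (e s (w, o)) =
        Real.exp (u * deviation μ ℓ Summ O θo alg s (w, o)) * Real.exp (-ψ s w) := fun o => by
      rw [← Real.exp_add, ← sub_eq_add_neg]
    simp only [heq]
    rw [← ofReal_integral_eq_lintegral_ofReal (hint.mul_const _)
      (.of_forall fun o => by positivity), integral_mul_const, ← ENNReal.ofReal_one]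
    refine ENNReal.ofReal_le_ofReal ?_
    calc _ ≤ Real.exp (ψ s w) * Real.exp (-ψ s w) := by gcongr; exact hω u hu
      _ = 1 := by rw [← Real.exp_add]; simp
  have hone := lintegral_prod_le_one (μ := μ) hO hSumm
    (g := fun s p => ENNReal.ofReal (Real.exp (e s p)))
    (fun s => ((he s).exp).ennreal_ofReal) hstep t
  simp only [← ENNReal.ofReal_prod_of_nonneg fun s (_ : s ∈ Finset.range t) => (Real.exp_pos _).le,
    ← Real.exp_sum] at hone
  have hm : Measurable fun ω => ENNReal.ofReal (Real.exp (∑ s ∈ Finset.range t,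
      e s (sliceInfo Summ O s ω, slice O s ω))) :=
    ((Finset.measurable_sum _ fun s _ => (he s).comp
      ((measurable_sliceInfo hSumm hO s).prodMk (measurable_slice hO s))).exp).ennreal_ofReal
  -- Markov's inequality for the exponential supermartingale.
  have hM := (mul_meas_ge_le_lintegral (μ := μ) hm (ENNReal.ofReal (Real.exp E))).trans hone
  have hset : {ω | E ≤ ∑ s ∈ Finset.range t, e s (sliceInfo Summ O s ω, slice O s ω)} =
      {ω | ENNReal.ofReal (Real.exp E) ≤ ENNReal.ofReal (Real.exp (∑ s ∈ Finset.range t,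
        e s (sliceInfo Summ O s ω, slice O s ω)))} := by
    ext ω
    simp only [Set.mem_ofPred_eq]
    rw [ENNReal.ofReal_le_ofReal_iff (Real.exp_pos _).le, Real.exp_le_exp]
  rw [← hset] at hM
  change μ.real {ω | E ≤ ∑ s ∈ Finset.range t, e s (sliceInfo Summ O s ω, slice O s ω)} ≤ _
  have h2 : Real.exp E * μ.real {ω | E ≤ ∑ s ∈ Finset.range t,
      e s (sliceInfo Summ O s ω, slice O s ω)} ≤ 1 := by
    have := ENNReal.toReal_mono ENNReal.one_ne_top hM
    rwa [ENNReal.toReal_mul, ENNReal.toReal_ofReal (Real.exp_pos _).le, ENNReal.toReal_one] at this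
  rw [Real.exp_neg, ← one_div, le_div_iff₀ (Real.exp_pos _), mul_comm]
  exact h2

/-- With `K = a ^ β * y ^ (1 - β) / ((1 + a) * γ)`, the exponent in the deviation bounds is
`ρ * t * y / (2 * (1 + a) * (1 / K + b / 3))`. -/
lemma measure_deviation_le [Nonempty A]
    (hℓ : Measurable (fun p : Θ × 𝒪 × 𝒵 => ℓ p.1 p.2.1 p.2.2))
    (halg : ∀ s, Measurable (alg s)) (hO : ∀ s α, Measurable (O s α)) (hSumm : Measurable Summ)
    {θstar : Θ} (h1 : SharedRisk μ ℓ Summ O θstar) {b₁ b₂ : ℝ}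
    (h2 : BoundedLoss μ ℓ Summ O θo b₁ b₂) {β γ : ℝ} (h3 : VarianceBound μ ℓ Summ O θo β γ)
    {ρ : ℝ} (hρ : 0 < ρ) (hdev : HasSubgammaDeviations μ ℓ Summ O θo alg b₂ β γ ρ)
    {t : ℕ} (ht : 1 ≤ t) {a y : ℝ} (ha : 0 < a) (hy : 0 < y) {σ : ℝ} (hσ : |σ| = 1) :
    μ.real {ω | (y + a * cumRisk μ ℓ Summ O θo alg t ω) / (1 + a) ≤
        σ * cumDeviation μ ℓ Summ O θo alg t ω} ≤
      Real.exp (-(ρ * t * y / (2 * (1 + a) *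
        ((1 + a) * γ / (a ^ β * y ^ (1 - β)) + b₂ / 3)))) := by
  have hb := h2.b₂_pos
  have hγ := h3.γ_pos
  have ht0 : (0 : ℝ) < t := by exact_mod_cast ht
  have hK0 : 0 < a ^ β * y ^ (1 - β) := by positivity
  set k : ℝ := (1 + a) * γ / (a ^ β * y ^ (1 - β)) with hk
  have hkpos : 0 < k := by positivity
  set lam : ℝ := ρ / (k + b₂ / 3) with hlam
  have hlpos : 0 < lam := by positivity
  have hσ2 : σ ^ 2 = 1 := by rw [← sq_abs, hσ, one_pow]
  have habs : |σ * lam| = lam := by rw [abs_mul, hσ, one_mul, abs_of_pos hlpos]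
  have hratio : lam * b₂ / (3 * ρ) = (b₂ / 3) / (k + b₂ / 3) := by
    rw [hlam]; field_simp
  have hone : 1 - |σ * lam| * b₂ / (3 * ρ) = k / (k + b₂ / 3) := by
    rw [habs, hratio, eq_div_iff (by positivity), sub_mul, div_mul_cancel₀ _ (by positivity)]; ring
  have hu : |σ * lam| * b₂ < 3 * ρ := by
    have : 0 < 1 - |σ * lam| * b₂ / (3 * ρ) := by rw [hone]; positivity
    rwa [sub_pos, div_lt_one (by positivity)] at this
  have hcher := measure_le_exp_of_subgamma hℓ halg hO hSumm h2.sup_le hdev hu t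
    (ρ * t * y / (2 * (1 + a) * (k + b₂ / 3)))
  refine le_trans ?_ hcher
  refine ENNReal.toReal_mono (measure_ne_top _ _) (measure_mono_ae ?_)
  have hpos : ∀ᵐ ω ∂μ, ∀ s, 0 ≤ excessRisk μ ℓ Summ O θo alg s (sliceInfo Summ O s ω) :=
    ae_all_iff.2 fun s => (ae_slice_bounds hℓ halg hO hSumm h1 h2 h3 s).mono fun ω h => h.1
  filter_upwards [hpos] with ω hpos hω
  change (y + a * cumRisk μ ℓ Summ O θo alg t ω) / (1 + a) ≤
        σ * cumDeviation μ ℓ Summ O θo alg t ω at hω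
  change ρ * t * y / (2 * (1 + a) * (k + b₂ / 3)) ≤ ∑ s ∈ Finset.range t, _
  set D := cumDeviation μ ℓ Summ O θo alg t ω with hD
  set H := cumRisk μ ℓ Summ O θo alg t ω with hH
  have hDsum : ∑ s ∈ Finset.range t, deviation μ ℓ Summ O θo alg s
      (sliceInfo Summ O s ω, slice O s ω) = t * D := by
    rw [hD, cumDeviation]; field_simp
  have hH0 : 0 ≤ H := by
    rw [hH, cumRisk]
    have := Finset.sum_nonneg fun s (_ : s ∈ Finset.range t) => hpos s
    positivity
  have hHsum : ∑ s ∈ Finset.range t, excessRisk μ ℓ Summ O θo alg s (sliceInfo Summ O s ω) ^ β ≤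
      t * H ^ β := by
    have := sum_rpow_le_card_mul (Finset.range t) (Finset.nonempty_range_iff.2 (by omega))
      (f := fun s => excessRisk μ ℓ Summ O θo alg s (sliceInfo Summ O s ω)) (fun s _ => hpos s)
      h3.β_pos.le h3.β_le
    rw [Finset.card_range] at this
    exact this
  have hψ : ∀ h : ℝ, (σ * lam) ^ 2 * (γ * h) / (2 * ρ * (1 - |σ * lam| * b₂ / (3 * ρ))) =
      lam * (a ^ β * y ^ (1 - β)) / (2 * (1 + a)) * h := fun h => by
    rw [hone, mul_pow, hσ2, hlam]
    have : k * (a ^ β * y ^ (1 - β)) = (1 + a) * γ := by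
      rw [hk, div_mul_cancel₀ _ hK0.ne']
    field_simp
    linear_combination (-h) * this
  rw [Finset.sum_sub_distrib, ← Finset.mul_sum, hDsum]
  simp only [hψ]
  rw [← Finset.mul_sum]
  have hAG := rpow_mul_rpow_le_add ha.le hy.le hH0 h3.β_pos.le h3.β_le
  -- With this `k`, the compensator is at most half of the lower bound `lam * t * (y + a * H) / (1 +
  -- a)` on the linear term; the remaining half contains the exponent.
  have h5 : lam * (a ^ β * y ^ (1 - β)) / (2 * (1 + a)) * ∑ s ∈ Finset.range t,
      excessRisk μ ℓ Summ O θo alg s (sliceInfo Summ O s ω) ^ β ≤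
      lam * t / (2 * (1 + a)) * (a * H + y) := by
    calc _ ≤ lam * (a ^ β * y ^ (1 - β)) / (2 * (1 + a)) * (t * H ^ β) := by gcongr
      _ = lam * t / (2 * (1 + a)) * (a ^ β * H ^ β * y ^ (1 - β)) := by ring
      _ ≤ _ := by gcongr
  have h6 : lam * t * ((y + a * H) / (1 + a)) ≤ σ * lam * (t * D) := by
    calc lam * t * ((y + a * H) / (1 + a)) ≤ lam * t * (σ * D) := by gcongr
      _ = _ := by ring
  have h7 : lam * t * ((y + a * H) / (1 + a)) - lam * t / (2 * (1 + a)) * (a * H + y) =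
      lam * t * y / (2 * (1 + a)) + lam * t * (a * H) / (2 * (1 + a)) := by
    field_simp; ring
  have h8 : ρ * t * y / (2 * (1 + a) * (k + b₂ / 3)) = lam * t * y / (2 * (1 + a)) := by
    rw [hlam]; field_simp
  have h9 : 0 ≤ lam * t * (a * H) / (2 * (1 + a)) := by positivity
  linarith

end Tails

/-! ### From deviations to the oracle inequality -/

section Oracle

variable {Ω A 𝒪 𝒵 Θ : Type*} [MeasurableSpace Ω] [Fintype A] [MeasurableSpace 𝒪]
  [MeasurableSpace 𝒵] [StandardBorelSpace 𝒪] [Nonempty 𝒪] {μ : Measure Ω} [IsProbabilityMeasure μ]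
  {ℓ : Θ → 𝒪 → 𝒵 → ℝ} {Summ : (A → 𝒪) → A → 𝒵} {O : ℕ → A → Ω → 𝒪} {θo : Θ}

lemma empRisk_sub_eq (alg : Algorithm A 𝒪 Θ) (t : ℕ) (ω : Ω) :
    empRisk ℓ Summ O alg t ω - empRisk ℓ Summ O (constAlg θo) t ω =
      cumDeviation μ ℓ Summ O θo alg t ω + cumRisk μ ℓ Summ O θo alg t ω := by
  have h : ∀ s, avgLossAt ℓ Summ O (learned alg O s) s ω -
      avgLossAt ℓ Summ O (learned (constAlg θo) O s) s ω =
      deviation μ ℓ Summ O θo alg s (sliceInfo Summ O s ω, slice O s ω) +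
        excessRisk μ ℓ Summ O θo alg s (sliceInfo Summ O s ω) := fun s => by
    rw [deviation, sub_add_cancel]
    exact (average_sub _ _).symm
  rw [empRisk, empRisk, cumDeviation, cumRisk, ← mul_sub, ← mul_add, ← Finset.sum_sub_distrib,
    ← Finset.sum_add_distrib]
  simp only [h]

variable [MeasurableSpace Θ]

/-- Subtracting the reference loss leaves a bounded variable, whose conditional expectation is an
integral against the slice law. The equality is only almost sure, as the risks are defined from
versions of conditional expectations. -/
lemma risk_sub_ae_eq (hℓ : Measurable (fun p : Θ × 𝒪 × 𝒵 => ℓ p.1 p.2.1 p.2.2))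
    {alg : Algorithm A 𝒪 Θ} (halg : ∀ s, Measurable (alg s)) (hO : ∀ s α, Measurable (O s α))
    (hSumm : Measurable Summ) {b₁ : ℝ} (hb₁ : ∀ θ o z, |excessLoss ℓ θo θ o z| ≤ b₁)
    (hint : ∀ s α, Integrable (lossAt ℓ Summ O (fun _ => θo) s α) μ) (t : ℕ) :
    ∀ᵐ ω ∂μ, risk μ ℓ Summ O alg t ω - risk μ ℓ Summ O (constAlg θo) t ω =
      cumRisk μ ℓ Summ O θo alg t ω := by
  have h : ∀ᵐ ω ∂μ, ∀ s,
      (μ[avgLossAt ℓ Summ O (learned alg O s) s | sliceSigma Summ O s]) ω -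
        (μ[avgLossAt ℓ Summ O (learned (constAlg θo) O s) s | sliceSigma Summ O s]) ω =
      excessRisk μ ℓ Summ O θo alg s (sliceInfo Summ O s ω) := by
    rw [ae_all_iff]
    intro s
    have hW := measurable_sliceInfo hSumm hO s
    have hU := measurable_slice hO s
    have hxm := fun α => measurable_excessAt (𝒵 := 𝒵) hℓ θo halg s α
    have hxi : ∀ α, Integrable
        (fun ω => excessAt ℓ θo alg s α (sliceInfo Summ O s ω, slice O s ω)) μ := fun α =>
      integrable_of_ae_abs_le ((hxm α).comp (hW.prodMk hU)) (.of_forall fun ω => hb₁ _ _ _)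
    have hX : Integrable (fun ω => average fun α =>
        excessAt ℓ θo alg s α (sliceInfo Summ O s ω, slice O s ω)) μ :=
      (integrable_finsetSum _ fun α _ => hxi α).const_mul _
    have hL0 : Integrable (avgLossAt ℓ Summ O (learned (constAlg θo) O s) s) μ :=
      (integrable_finsetSum _ fun α _ => hint s α).const_mul _
    have hL : avgLossAt ℓ Summ O (learned alg O s) s =
        (fun ω => average fun α =>
          excessAt ℓ θo alg s α (sliceInfo Summ O s ω, slice O s ω)) +
        avgLossAt ℓ Summ O (learned (constAlg θo) O s) s := by
      ext ω
      rw [Pi.add_apply, ← sub_eq_iff_eq_add]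
      exact (average_sub _ _).symm
    have e1 := condExp_add hX hL0 (sliceSigma Summ O s)
    have e2 := condExp_prod_ae_eq_integral_condDistrib (μ := μ) hW hU.aemeasurable
      (f := fun p => average fun α => excessAt ℓ θo alg s α p)
      (measurable_average hxm).stronglyMeasurable hX
    rw [hL]
    filter_upwards [e1, e2] with ω e1 e2
    rw [e1, Pi.add_apply, add_sub_cancel_right, e2]
    exact integral_average fun α => integrable_of_ae_abs_le
      ((hxm α).comp measurable_prodMk_left) (.of_forall fun o => hb₁ _ _ _)
  filter_upwards [h] with ω h
  rw [risk, risk, cumRisk, ← mul_sub, ← Finset.sum_sub_distrib]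
  simp only [h]

/-- The oracle inequality, given the sub-gamma property of the deviations. -/
lemma measure_oracle_le [Nonempty A]
    (hℓ : Measurable (fun p : Θ × 𝒪 × 𝒵 => ℓ p.1 p.2.1 p.2.2))
    {J : ℕ} {alg : Fin J → Algorithm A 𝒪 Θ}
    (halg : ∀ j s, Measurable (alg j s)) (hO : ∀ s α, Measurable (O s α)) (hSumm : Measurable Summ)
    {θstar : Θ} (h1 : SharedRisk μ ℓ Summ O θstar) {b₁ b₂ : ℝ}
    (h2 : BoundedLoss μ ℓ Summ O θo b₁ b₂) {β γ : ℝ} (h3 : VarianceBound μ ℓ Summ O θo β γ)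
    {ρ : ℝ} (hρ : 0 < ρ)
    (hdev : ∀ j, HasSubgammaDeviations μ ℓ Summ O θo (alg j) b₂ β γ ρ)
    {t : ℕ} (ht : 1 ≤ t) {jhat : Ω → Fin J}
    (hjhat : ∀ᵐ ω ∂μ, ∀ j,
      empRisk ℓ Summ O (alg (jhat ω)) t ω ≤ empRisk ℓ Summ O (alg j) t ω)
    (jtilde : Ω → Fin J) {a x : ℝ} (ha : 0 < a) (hx : 0 < x) :
    μ.real {ω | (1 + 2 * a) * (risk μ ℓ Summ O (alg (jtilde ω)) t ω
          - risk μ ℓ Summ O (constAlg θo) t ω) + x ≤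
        risk μ ℓ Summ O (alg (jhat ω)) t ω - risk μ ℓ Summ O (constAlg θo) t ω} ≤
      2 * J * Real.exp (-(ρ * t * (x / 2) / (2 * (1 + a) *
        ((1 + a) * γ / (a ^ β * (x / 2) ^ (1 - β)) + b₂ / 3)))) := by
  set q := Real.exp (-(ρ * t * (x / 2) / (2 * (1 + a) *
        ((1 + a) * γ / (a ^ β * (x / 2) ^ (1 - β)) + b₂ / 3))))
  let B : Fin J → ℝ → Set Ω := fun j σ =>
    {ω | (x / 2 + a * cumRisk μ ℓ Summ O θo (alg j) t ω) / (1 + a) ≤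
        σ * cumDeviation μ ℓ Summ O θo (alg j) t ω}
  have hB : ∀ j σ, |σ| = 1 → μ.real (B j σ) ≤ q := fun j σ hσ =>
    measure_deviation_le hℓ (halg j) hO hSumm h1 h2 h3 hρ (hdev j) ht ha (half_pos hx) hσ
  have hrisk : ∀ᵐ ω ∂μ, ∀ j, risk μ ℓ Summ O (alg j) t ω - risk μ ℓ Summ O (constAlg θo) t ω =
      cumRisk μ ℓ Summ O θo (alg j) t ω := ae_all_iff.2 fun j =>
    risk_sub_ae_eq hℓ (halg j) hO hSumm h2.sup_le
      (fun s α => (h1.sq_integrable θo s α).integrable one_le_two) t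
  calc _ ≤ μ.real (⋃ j, (B j 1 ∪ B j (-1))) := by
        -- The selected indices need not be measurable; monotonicity and the union bound hold for
        -- arbitrary sets.
        refine ENNReal.toReal_mono (measure_ne_top _ _) (measure_mono_ae ?_)
        filter_upwards [hrisk, hjhat] with ω hrisk hjhat hω
        change (1 + 2 * a) * (risk μ ℓ Summ O (alg (jtilde ω)) t ω
          - risk μ ℓ Summ O (constAlg θo) t ω) + x ≤
          risk μ ℓ Summ O (alg (jhat ω)) t ω - risk μ ℓ Summ O (constAlg θo) t ω at hω
        change ω ∈ ⋃ j, (B j 1 ∪ B j (-1))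
        rw [hrisk, hrisk] at hω
        have hemp := hjhat (jtilde ω)
        have e1 := empRisk_sub_eq (μ := μ) (ℓ := ℓ) (Summ := Summ) (O := O) (θo := θo)
          (alg (jhat ω)) t ω
        have e2 := empRisk_sub_eq (μ := μ) (ℓ := ℓ) (Summ := Summ) (O := O) (θo := θo)
          (alg (jtilde ω)) t ω
        by_contra hcon
        simp only [Set.mem_iUnion, Set.mem_union, not_exists, not_or] at hcon
        have c1 : ¬ (x / 2 + a * cumRisk μ ℓ Summ O θo (alg (jhat ω)) t ω) / (1 + a) ≤
          -1 * cumDeviation μ ℓ Summ O θo (alg (jhat ω)) t ω := (hcon (jhat ω)).2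
        have c2 : ¬ (x / 2 + a * cumRisk μ ℓ Summ O θo (alg (jtilde ω)) t ω) / (1 + a) ≤
          1 * cumDeviation μ ℓ Summ O θo (alg (jtilde ω)) t ω := (hcon (jtilde ω)).1
        rw [not_le, lt_div_iff₀ (by positivity)] at c1 c2
        have hemp' : (1 + a) * (cumDeviation μ ℓ Summ O θo (alg (jhat ω)) t ω +
            cumRisk μ ℓ Summ O θo (alg (jhat ω)) t ω) ≤
            (1 + a) * (cumDeviation μ ℓ Summ O θo (alg (jtilde ω)) t ω +
            cumRisk μ ℓ Summ O θo (alg (jtilde ω)) t ω) :=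
          mul_le_mul_of_nonneg_left (by linarith) (by positivity)
        linarith
    _ ≤ ∑ j, μ.real (B j 1 ∪ B j (-1)) := measureReal_iUnion_fintype_le _
    _ ≤ ∑ _j : Fin J, (q + q) := Finset.sum_le_sum fun j _ =>
        (measureReal_union_le _ _).trans (add_le_add (hB j 1 (by simp)) (hB j (-1) (by simp)))
    _ = 2 * J * q := by simp; ring

end Oracle

/-! ### Matching the exponents with the stated constants -/

section Exponents

/-- The sum `k + d` is at most twice its larger term. This separates the variance regime from the
range regime. -/
lemma exp_neg_div_add_le {c k d : ℝ} (hc : 0 ≤ c) (hk : 0 < k) (hd : 0 < d) :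
    Real.exp (-(c / (k + d))) ≤ Real.exp (-(c / (2 * k))) + Real.exp (-(c / (2 * d))) := by
  rcases le_total k d with h | h
  · have h1 : c / (2 * d) ≤ c / (k + d) := by gcongr; linarith
    have := Real.exp_le_exp.2 (neg_le_neg h1)
    have := Real.exp_pos (-(c / (2 * k)))
    linarith
  · have h1 : c / (2 * k) ≤ c / (k + d) := by gcongr; linarith
    have := Real.exp_le_exp.2 (neg_le_neg h1)
    have := Real.exp_pos (-(c / (2 * d)))
    linarith

lemma exp_exponent_le {ρ a x β γ b : ℝ} {t : ℕ} (hρ : 0 ≤ ρ) (ha : 0 < a) (hx : 0 < x)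
    (hγ : 0 < γ) (hb : 0 < b) :
    Real.exp (-(ρ * t * (x / 2) / (2 * (1 + a) *
        ((1 + a) * γ / (a ^ β * (x / 2) ^ (1 - β)) + b / 3)))) ≤
      Real.exp (-(2 * ρ * (t * x ^ (2 - β) / C₁ β γ a))) +
        Real.exp (-(ρ * (t * x / C₂ b a))) := by
  have h := exp_neg_div_add_le (c := ρ * t * (x / 2) / (2 * (1 + a)))
    (k := (1 + a) * γ / (a ^ β * (x / 2) ^ (1 - β))) (d := b / 3)
    (by positivity) (by positivity) (by positivity)
  rw [div_div] at h
  refine h.trans (le_of_eq ?_)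
  have hx1 : (x / 2) ^ (1 - β) = x ^ (2 - β) / x * (2 ^ β / 2) := by
    rw [Real.div_rpow hx.le zero_le_two, Real.rpow_sub two_pos, Real.rpow_one,
      show (1 - β : ℝ) = (2 - β) - 1 by ring, Real.rpow_sub_one hx.ne']
    field_simp
  have h2 : (2 : ℝ) ^ (5 - β) = 32 / 2 ^ β := by
    rw [Real.rpow_sub two_pos]; norm_num
  have p1 : (0 : ℝ) < 2 ^ β := by positivity
  have p2 : 0 < x ^ (2 - β) := by positivity
  have p3 : 0 < a ^ β := by positivity
  congr 3
  · rw [hx1, C₁, h2]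
    field_simp
    norm_num
  · rw [C₂]
    field_simp
    norm_num

/-- The derived rate has a factor `t` where the stated one has `t ^ (-β)`; with `t ≥ 1`, the
comparison reduces to `2 * C₁ ≤ C₁'`. -/
lemma rate_le_rate' {r a x β γ : ℝ} {t : ℕ} (ht : 1 ≤ t) (hr : 0 ≤ r) (ha : 0 < a) (hx : 0 < x)
    (hβ : 0 ≤ β) (hγ : 0 < γ) :
    r / (t : ℝ) ^ β * x ^ (2 - β) / C₁' β γ a ≤ 2 * (r / 4) * (t * x ^ (2 - β) / C₁ β γ a) := by
  have ht' : (1 : ℝ) ≤ t := by exact_mod_cast ht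
  have htβ : 1 ≤ (t : ℝ) ^ β := Real.one_le_rpow ht' hβ
  have hC : 2 * C₁ β γ a ≤ C₁' β γ a := by
    have h1 : (2 : ℝ) ^ (5 - β) ≤ 2 ^ (5 : ℝ) :=
      Real.rpow_le_rpow_of_exponent_le one_le_two (by linarith)
    have h2 : (2 : ℝ) ^ (6 : ℝ) ≤ 2 ^ (6 + 2 * β) :=
      Real.rpow_le_rpow_of_exponent_le one_le_two (by linarith)
    have h3 : (1 : ℝ) ≤ Real.exp 1 ^ 2 := one_le_pow₀ (Real.one_le_exp zero_le_one)
    have h4 : 2 * (2 : ℝ) ^ (5 - β) ≤ 2 ^ (6 + 2 * β) * Real.exp 1 ^ 2 := by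
      calc 2 * (2 : ℝ) ^ (5 - β) ≤ 2 * 2 ^ (5 : ℝ) := by gcongr
        _ = 2 ^ (6 : ℝ) * 1 := by norm_num
        _ ≤ _ := by gcongr
    rw [C₁, C₁', ← mul_div_assoc]
    refine div_le_div_of_nonneg_right ?_ (by positivity)
    calc 2 * ((2 : ℝ) ^ (5 - β) * (1 + a) ^ 2 * γ) = 2 * (2 : ℝ) ^ (5 - β) * ((1 + a) ^ 2 * γ) := by
          ring
      _ ≤ 2 ^ (6 + 2 * β) * Real.exp 1 ^ 2 * ((1 + a) ^ 2 * γ) := by gcongr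
      _ = _ := by ring
  have hC0 : 0 < C₁ β γ a := by unfold C₁; positivity
  calc r / (t : ℝ) ^ β * x ^ (2 - β) / C₁' β γ a ≤ r / 1 * x ^ (2 - β) / (2 * C₁ β γ a) := by
        gcongr
    _ = 2 * (r / 4) * (1 * x ^ (2 - β) / C₁ β γ a) := by field_simp; norm_num
    _ ≤ _ := by gcongr

lemma linear_rate_le_linear_rate' {r a x b : ℝ} {t : ℕ} (ht : 1 ≤ t) (hr : 0 ≤ r) (ha : 0 < a)
    (hx : 0 < x) (hb : 0 < b) : r * x / C₂' b a ≤ r / 4 * (t * x / C₂ b a) := by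
  have ht' : (1 : ℝ) ≤ t := by exact_mod_cast ht
  have hC0 : 0 < C₂ b a := by unfold C₂; positivity
  have hC : 4 * C₂ b a ≤ C₂' b a := by
    have h3 : (1 : ℝ) ≤ Real.exp 1 := Real.one_le_exp zero_le_one
    have h4 : 0 < (1 + a) * b := by positivity
    rw [C₂, C₂']
    nlinarith
  calc r * x / C₂' b a ≤ r * x / (4 * C₂ b a) := by gcongr
    _ = r / 4 * (1 * x / C₂ b a) := by field_simp
    _ ≤ _ := by gcongr

end Exponents

end SuperLearner

/-! ### The oracular inequality -/

theorem theorem1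
    {Ω A 𝒪 𝒵 Θ : Type*} [MeasurableSpace Ω] (μ : MeasureTheory.Measure Ω)
    [MeasureTheory.IsProbabilityMeasure μ] [Fintype A] [Nonempty A]
    [MeasurableSpace 𝒪] [StandardBorelSpace 𝒪] [Nonempty 𝒪] [MeasurableSpace 𝒵]
    [MeasurableSpace Θ]
    -- the observations, their summaries, the loss
    (O : ℕ → A → Ω → 𝒪) (hO : ∀ s α, Measurable (O s α))
    (Summ : (A → 𝒪) → A → 𝒵) (hSumm : Measurable Summ)
    (ℓ : Θ → 𝒪 → 𝒵 → ℝ) (hℓ : Measurable (fun p : Θ × 𝒪 × 𝒵 => ℓ p.1 p.2.1 p.2.2))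
    -- the algorithms
    {J : ℕ} (Θs : Fin J → Set Θ) (alg : Fin J → SuperLearner.Algorithm A 𝒪 Θ)
    (halg : ∀ j s, Measurable (alg j s)) (hmem : ∀ j s h, alg j s h ∈ Θs j)
    -- the reference parameter
    (θo : Θ)
    (hθo : ∀ t : ℕ, 1 ≤ t → ∀ j, ∀ θ ∈ Θs j, ∀ᵐ ω ∂μ,
      SuperLearner.risk μ ℓ Summ O (SuperLearner.constAlg θo) t ω ≤
        SuperLearner.risk μ ℓ Summ O (SuperLearner.constAlg θ) t ω)
    -- the assumptions
    (G : SimpleGraph A) [DecidableRel G.Adj] (h0 : SuperLearner.DependencyGraph μ Summ O G)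
    (θstar : Θ) (h1 : SuperLearner.SharedRisk μ ℓ Summ O θstar)
    (b₁ b₂ : ℝ) (h2 : SuperLearner.BoundedLoss μ ℓ Summ O θo b₁ b₂)
    (β γ : ℝ) (h3 : SuperLearner.VarianceBound μ ℓ Summ O θo β γ)
    (v₁ : ℝ) (h4 : SuperLearner.BoundedCondVariance μ ℓ Summ O θo v₁)
    -- the indices of the Super Learner and of the oracle (arbitrary minimizers)
    (jhat : ℕ → Ω → Fin J)
    (hjhat : ∀ t : ℕ, 1 ≤ t → ∀ᵐ ω ∂μ, ∀ j,
      SuperLearner.empRisk ℓ Summ O (alg (jhat t ω)) t ω ≤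
        SuperLearner.empRisk ℓ Summ O (alg j) t ω)
    (jtilde : ℕ → Ω → Fin J)
    (hjtilde : ∀ t : ℕ, 1 ≤ t → ∀ᵐ ω ∂μ, ∀ j,
      SuperLearner.risk μ ℓ Summ O (alg (jtilde t ω)) t ω ≤
        SuperLearner.risk μ ℓ Summ O (alg j) t ω)
    (N N' : ℕ) (hN : 2 ≤ N) (hN' : 2 ≤ N') (a : ℝ) (ha : 0 < a) :
    (∀ (t : ℕ) (x : ℝ), 1 ≤ t →
      SuperLearner.xLow (SuperLearner.ratio G) b₂ v₁ β γ a N ≤ x →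
      μ.real {ω |
          (1 + 2 * a) * (SuperLearner.risk μ ℓ Summ O (alg (jtilde t ω)) t ω
            - SuperLearner.risk μ ℓ Summ O (SuperLearner.constAlg θo) t ω) + x ≤
          SuperLearner.risk μ ℓ Summ O (alg (jhat t ω)) t ω
            - SuperLearner.risk μ ℓ Summ O (SuperLearner.constAlg θo) t ω} ≤
        2 * J * N * (Real.exp (-(t * x ^ (2 - β) / SuperLearner.C₁ β γ a))
          + Real.exp (-(t * x / SuperLearner.C₂ b₂ a)))) ∧
    (∀ (t : ℕ) (x : ℝ), 1 ≤ t →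
      SuperLearner.xLow' b₁ a N' ≤ x →
      μ.real {ω |
          (1 + 2 * a) * (SuperLearner.risk μ ℓ Summ O (alg (jtilde t ω)) t ω
            - SuperLearner.risk μ ℓ Summ O (SuperLearner.constAlg θo) t ω) + x ≤
          SuperLearner.risk μ ℓ Summ O (alg (jhat t ω)) t ω
            - SuperLearner.risk μ ℓ Summ O (SuperLearner.constAlg θo) t ω} ≤
        2 * Real.exp 1 ^ 2 * J * N' *
          (Real.exp (-((Fintype.card A : ℝ) / ((t : ℝ) ^ β * SuperLearner.graphDeg G)
              * x ^ (2 - β) / SuperLearner.C₁' β γ a))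
            + Real.exp (-(SuperLearner.ratio G * x / SuperLearner.C₂' b₂ a)))) := by
  have hA : (0 : ℝ) < Fintype.card A := by exact_mod_cast Fintype.card_pos
  have hg : 0 < SuperLearner.graphDeg G := by unfold SuperLearner.graphDeg; positivity
  have hr : 0 < SuperLearner.ratio G := div_pos hA hg
  have hb₁ := h2.b₁_pos
  have hb₂ := h2.b₂_pos
  have hγ := h3.γ_pos
  have hv₁ := h4.v₁_pos
  constructor
  · intro t x ht hx
    -- The threshold is a positive number, and positivity of `x` is what the deviation bound
    -- requires.
    have hx0 : 0 < x := by
      refine lt_of_lt_of_le ?_ hx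
      unfold SuperLearner.xLow SuperLearner.v₂
      positivity
    refine (SuperLearner.measure_oracle_le hℓ halg hO hSumm h1 h2 h3 one_pos
      (fun j => SuperLearner.hasSubgammaDeviations_one hℓ (halg j) hO hSumm h1 h2 h3) ht
      (hjhat t ht) (jtilde t) ha hx0).trans ?_
    have hN1 : (1 : ℝ) ≤ N := by exact_mod_cast (by omega : 1 ≤ N)
    have hC0 : 0 < SuperLearner.C₁ β γ a := by unfold SuperLearner.C₁; positivity
    have hq := SuperLearner.exp_exponent_le (ρ := 1) (t := t) (β := β) zero_le_one ha hx0 hγ hb₂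
    have hexp : Real.exp (-(2 * 1 * (t * x ^ (2 - β) / SuperLearner.C₁ β γ a))) ≤
        Real.exp (-(t * x ^ (2 - β) / SuperLearner.C₁ β γ a)) := by
      have : 0 ≤ t * x ^ (2 - β) / SuperLearner.C₁ β γ a := by positivity
      exact Real.exp_le_exp.2 (by linarith)
    rw [one_mul (t * x / SuperLearner.C₂ b₂ a)] at hq
    calc _ ≤ 2 * J * (1 : ℝ) * (Real.exp (-(t * x ^ (2 - β) / SuperLearner.C₁ β γ a))
          + Real.exp (-(t * x / SuperLearner.C₂ b₂ a))) := by
          rw [mul_one]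
          exact mul_le_mul_of_nonneg_left (by linarith) (by positivity)
      _ ≤ _ := by gcongr
  · intro t x ht hx
    have hx0 : 0 < x := by
      refine lt_of_lt_of_le ?_ hx
      unfold SuperLearner.xLow'
      positivity
    refine (SuperLearner.measure_oracle_le hℓ halg hO hSumm h1 h2 h3
      (ρ := SuperLearner.ratio G / 4) (by positivity)
      (fun j => SuperLearner.hasSubgammaDeviations_ratio hℓ (halg j) hO hSumm G h0 h1 h2 h3) ht
      (hjhat t ht) (jtilde t) ha hx0).trans ?_
    have hN1 : (1 : ℝ) ≤ N' := by exact_mod_cast (by omega : 1 ≤ N')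
    have he : (1 : ℝ) ≤ Real.exp 1 ^ 2 := one_le_pow₀ (Real.one_le_exp zero_le_one)
    have hq := SuperLearner.exp_exponent_le (ρ := SuperLearner.ratio G / 4) (t := t) (β := β)
      (by positivity) ha hx0 hγ hb₂
    have e1 := SuperLearner.rate_le_rate' ht hr.le ha hx0 h3.β_pos.le hγ
    have e2 := SuperLearner.linear_rate_le_linear_rate' ht hr.le ha hx0 hb₂
    have hdiv : (Fintype.card A : ℝ) / ((t : ℝ) ^ β * SuperLearner.graphDeg G) =
        SuperLearner.ratio G / (t : ℝ) ^ β := by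
      rw [SuperLearner.ratio, div_div, mul_comm]
    rw [hdiv]
    have f1 := Real.exp_le_exp.2 (neg_le_neg e1)
    have f2 := Real.exp_le_exp.2 (neg_le_neg e2)
    calc _ ≤ 2 * 1 * J * (1 : ℝ) * (Real.exp (-(SuperLearner.ratio G / (t : ℝ) ^ β
              * x ^ (2 - β) / SuperLearner.C₁' β γ a))
            + Real.exp (-(SuperLearner.ratio G * x / SuperLearner.C₂' b₂ a))) := by
          rw [mul_one, mul_one]
          exact mul_le_mul_of_nonneg_left (by linarith) (by positivity)
      _ ≤ _ := by gcongr
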